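/- Let $m\ge 0$, let $X=\{x_0,x_1,\dots,x_m\}$ be an alphabet, $X^*$ the set of words with empty word $\mathbf 1$ and length $|\cdot|$, and let $\mathbb R\langle\langle X\rangle\rangle$ be the space of formal power series $c=\sum_{\eta\in X^*}c(\eta)\eta$, with shuffle product $\sqcup\!\sqcup$ and its unit $\emptyset$ (the series $1\cdot\mathbf 1$). For $d=(d_1,\dots,d_m)\in\mathbb R\langle\langle X\rangle\rangle^m$ define on words $$\emptyset\curvearrowleft d=\emptyset,\qquad x_0\eta\curvearrowleft d=x_0(\eta\curvearrowleft d),\qquad x_i\eta\curvearrowleft d=x_i\bigl(d_i \sqcup\!\sqcup (\eta\curvearrowleft d)\bigr)\quad(1\le i\le m),$$ and $c\curvearrowleft d=\sum_{\eta}c(\eta)\,(\eta\curvearrowleft d)$ for $c\in\mathbb R\langle\langle X\rangle\rangle$. For $c,d\in\mathbb R\langle\langle X\rangle\rangle^m$ let $(c\star d)_j=d_j \sqcup\!\sqcup (c_j\curvearrowleft d)$. Let $M^m$ be the set of $c\in\mathbb R\langle\langle X\rangle\rangle^m$ with $c_j(\mathbf 1)=1$ for all $j$, with the product $\star$. Let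 $V$ be the vector space with basis the coordinate functions $a^j_\eta$ ($1\le j\le m$, $\eta\in X^*$; $a^j_\eta(c)=c_j(\eta)$), graded by $\deg a^j_\eta=|\eta|$, let $\mathcal B$ be its graded symmetric algebra, and let $\Delta:\mathcal B\to\mathcal B\otimes\mathcal B$ be the algebra map dual to $\star$, and $\nu:\mathcal B\to\mathbb R$ the algebra map with $\nu(a^j_{\mathbf 1})=1$ and $\nu(a^j_\eta)=0$ for $\eta\ne\mathbf 1$. Let $\mathcal H=\mathcal B/(a^1_{\mathbf 1}-1,\dots,a^m_{\mathbf 1}-1)$, with $\mathcal H_n$ the image of $\mathcal B_n$ and $V_n\subseteq\mathcal H_n$ the span of the classes of the $a^j_\eta$ with $|\eta|=n$. Then: 1. $\Delta(a^j_\eta)(c\otimes d)=(c\star d)_j(\eta)$ for all $c,d\in\mathbb R\langle\langle X\rangle\rangle^m$, $j$ and $\eta$; and $\Delta$, $\nu$ induce algebra maps on $\mathcal H$ which make $\mathcal H$ a bialgebra, and in fact a Hopf algebra. 2. This bialgebra is graded and connected: $\mathcal H=\bigoplus_{n\ge0}\mathcal H_n$ is a graded algebra, $\Delta(\mathcal H_n)\subseteq\bigoplus_{i+j=n}\mathcal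 H_i\otimes\mathcal H_j$, $\nu(\mathcal H_n)=0$ for $n\ge1$, and $\mathcal H_0=\mathbb R1$. It is right-handed: for every $n\ge1$ and $v\in V_n$, $\Delta(v)-1\otimes v-v\otimes1\in\bigoplus_{i+j=n,\ i,j\ge1}V_i\otimes\mathcal H_j$. 3. The group of characters of $\mathcal H$ (algebra maps $\mathcal H\to\mathbb R$ under convolution) is isomorphic to $(M^m,\star)$, by an isomorphism sending a character $\chi$ to the tuple $c$ with $c_j(\eta)=\chi(a^j_\eta)$. In particular $(M^m,\star)$ is a group. 4. If $m>1$, then $(M^m,\star)$ is not isomorphic, as an abstract group, to the $m$-fold direct product $(M,\star)\times\cdots\times(M,\star)$, where $(M,\star)$ is the group obtained for $m=1$, i.e. from the series in $x_0,x_1$ with constant term $1$. The same holds if instead $M$ denotes the series in $x_0,\dots,x_m$ with constant term $1$ and $c\star d=d \sqcup\!\sqcup (c\curvearrowleft\hat d)$, where, for a fixed subset $S\subseteq\{1,\dots,m\}$, $\hat d_i=d$ for $i\in S$ and $\hat d_i=\emptyset$ for $i\notin S$. -/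

import Mathlib

open scoped TensorProduct

namespace MultFeedback

/-! ### Words and noncommutative formal power series -/

/-- Words in the alphabet `x_0, x_1, …, x_m`; the letter `x_0` is `0 : Fin (m + 1)` and, for
`k : Fin m`, the letter with (one-based) index `k + 1` is `k.succ`.
The empty word is `[]`. -/
abbrev Word (m : ℕ) : Type := List (Fin (m + 1))

/-- Formal power series in the noncommuting letters `x_0, …, x_m` with coefficients in `R`. -/
abbrev Series (R : Type*) (m : ℕ) : Type _ := Word m → R

section Products

variable {R : Type*} [CommRing R] {m : ℕ}

/-- The series `∅`, the unit of the shuffle product: `1` on the empty word, `0` elsewhere. -/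
def unitSeries : Series R m := fun w => if w = [] then 1 else 0

/-- The terms `w' ⊗ w''` (with multiplicity) of the unshuffle coproduct of the word `w`, i.e. of
the multiplicative extension of `x ↦ x ⊗ 1 + 1 ⊗ x`. -/
def unshuffle {α : Type*} : List α → List (List α × List α)
  | [] => [([], [])]
  | x :: w =>
    (unshuffle w).map (fun p => (x :: p.1, p.2)) ++ (unshuffle w).map (fun p => (p.1, x :: p.2))

/-- The shuffle product of two series: convolution with respect to unshuffling. -/
def shuffle (c d : Series R m) : Series R m :=
  fun w => ((unshuffle w).map fun p => c p.1 * d p.2).sum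

/-- Left multiplication of a series by the letter `x`. -/
def letterMul (x : Fin (m + 1)) (c : Series R m) : Series R m
  | [] => 0
  | y :: w => if y = x then c w else 0

/-- The multiplicative mixed composition `η ↶ d` of a word `η` with an `m`-tuple `d`:
`∅ ↶ d = ∅`, `x_0 η ↶ d = x_0 (η ↶ d)` and `x_i η ↶ d = x_i (d_i ⧢ (η ↶ d))`. -/
def wordMixed (d : Fin m → Series R m) : Word m → Series R m
  | [] => unitSeries
  | x :: w => letterMul x
      (Fin.cases (motive := fun _ => Series R m) (wordMixed d w)
        (fun k => shuffle (d k) (wordMixed d w)) x)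

/-- The multiplicative mixed composition `c ↶ d = ∑_η c(η) (η ↶ d)`. The series `η ↶ d` is
supported on words of length at least the length of `η`, so the sum is finite at every word. -/
noncomputable def mixed (c : Series R m) (d : Fin m → Series R m) : Series R m :=
  fun w => ∑ᶠ η : Word m, c η * wordMixed d η w

/-- The multiplicative composition product `c ⋆ d = d ⧢ (c ↶ d)`, componentwise in `c`. -/
noncomputable def starProd (c d : Fin m → Series R m) : Fin m → Series R m :=
  fun j => shuffle (d j) (mixed (c j) d)

theorem mixed_nil (c : Series R m) (d : Fin m → Series R m) : mixed c d [] = c [] := by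
  unfold mixed
  rw [finsum_eq_single _ ([] : Word m)]
  · simp [wordMixed, unitSeries]
  · intro η hη
    cases η with
    | nil => exact absurd rfl hη
    | cons x w => simp [wordMixed, letterMul]

theorem shuffle_nil (c d : Series R m) : shuffle c d [] = c [] * d [] := by
  simp [shuffle, unshuffle]

theorem starProd_nil (c d : Fin m → Series R m) (j : Fin m) :
    starProd c d j [] = d j [] * c j [] := by
  simp [starProd, shuffle_nil, mixed_nil]

end Products

/-! ### The multiplicative feedback groups -/

/-- The underlying set of `M^m`: `m`-tuples of real series in `x_0, …, x_m` all of whose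
constant terms are `1`. -/
def FeedbackGroup (m : ℕ) : Type := {c : Fin m → Series ℝ m // ∀ j, c j [] = 1}

/-- The multiplication of `M^m` is `⋆`. -/
noncomputable instance (m : ℕ) : Mul (FeedbackGroup m) where
  mul c d := ⟨starProd c.1 d.1, fun j => by simp [starProd_nil, c.2 j, d.2 j]⟩

/-- The set `M` of single real series in `x_0, …, x_m` with constant term `1`, with the
one-component version of `⋆` in which the input channels in `S` are fed through:
`c ⋆ d = d ⧢ (c ↶ d̂)`, where `d̂_i = d` for `i ∈ S` and `d̂_i = ∅` for `i ∉ S`. -/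
def SingleFeedbackGroup (m : ℕ) (_S : Finset (Fin m)) : Type := {c : Series ℝ m // c [] = 1}

noncomputable instance (m : ℕ) (S : Finset (Fin m)) : Mul (SingleFeedbackGroup m S) where
  mul c d := ⟨shuffle d.1 (mixed c.1 fun i => if i ∈ S then d.1 else unitSeries),
    by simp [shuffle_nil, mixed_nil, c.2, d.2]⟩

/-! ### The bialgebra of coordinate functions and its quotient -/

/-- The symmetric algebra `𝓑` on the space `V` with basis the coordinate functions `a^j_η`. -/
abbrev CoordAlg (m : ℕ) : Type := MvPolynomial (Fin m × Word m) ℝ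

/-- The coordinate function `a^j_η`. -/
noncomputable def coord {m : ℕ} (j : Fin m) (w : Word m) : CoordAlg m := MvPolynomial.X (j, w)

/-- Evaluation of elements of `𝓑` at an `m`-tuple of series, `a^j_η ↦ c_j(η)`. -/
noncomputable def evalAt {m : ℕ} (c : Fin m → Series ℝ m) : CoordAlg m →ₐ[ℝ] ℝ :=
  MvPolynomial.aeval fun p => c p.1 p.2

/-- Evaluation of elements of `𝓑 ⊗ 𝓑` at `c ⊗ d`. -/
noncomputable def evalAt₂ {m : ℕ} (c d : Fin m → Series ℝ m) :
    CoordAlg m ⊗[ℝ] CoordAlg m →ₐ[ℝ] ℝ :=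
  Algebra.TensorProduct.productMap (evalAt c) (evalAt d)

/-- The coproduct `Δ` on `𝓑` dual to `⋆`: `Δ(a^j_η)` is the coefficient `(c ⋆ d)_j(η)` for the
generic tuples `c_j(η) = a^j_η ⊗ 1` and `d_j(η) = 1 ⊗ a^j_η`. -/
noncomputable def comulB (m : ℕ) : CoordAlg m →ₐ[ℝ] CoordAlg m ⊗[ℝ] CoordAlg m :=
  MvPolynomial.aeval fun p =>
    starProd (R := CoordAlg m ⊗[ℝ] CoordAlg m)
      (fun j w => coord j w ⊗ₜ[ℝ] 1) (fun j w => 1 ⊗ₜ[ℝ] coord j w) p.1 p.2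

/-- The counit `ν` on `𝓑`: `a^j_η ↦ 1` if `η` is the empty word, and `a^j_η ↦ 0` otherwise. -/
noncomputable def counitB (m : ℕ) : CoordAlg m →ₐ[ℝ] ℝ :=
  MvPolynomial.aeval fun p => if p.2 = [] then 1 else 0

/-- The ideal generated by the elements `a^j_𝟏 - 1`. -/
noncomputable def unitIdeal (m : ℕ) : Ideal (CoordAlg m) :=
  Ideal.span (Set.range fun j : Fin m => coord j [] - 1)

/-- The quotient algebra `𝓗`. -/
def FeedbackHopf (m : ℕ) : Type := CoordAlg m ⧸ unitIdeal m

noncomputable instance (m : ℕ) : CommRing (FeedbackHopf m) :=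
  inferInstanceAs (CommRing (CoordAlg m ⧸ unitIdeal m))

noncomputable instance (m : ℕ) : Algebra ℝ (FeedbackHopf m) :=
  inferInstanceAs (Algebra ℝ (CoordAlg m ⧸ unitIdeal m))

/-- The quotient map `𝓑 → 𝓗`. -/
noncomputable def proj (m : ℕ) : CoordAlg m →ₐ[ℝ] FeedbackHopf m :=
  Ideal.Quotient.mkₐ ℝ (unitIdeal m)

theorem proj_coord_nil {m : ℕ} (j : Fin m) : proj m (coord j []) = 1 := by
  rw [← map_one (proj m), ← sub_eq_zero, ← map_sub]
  exact Ideal.Quotient.eq_zero_iff_mem.mpr (Ideal.subset_span ⟨j, rfl⟩)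

theorem lift_condition {m : ℕ} {A : Type*} [Semiring A] [Algebra ℝ A] (f : CoordAlg m →ₐ[ℝ] A)
    (hf : ∀ j, f (coord j []) = 1) (a : CoordAlg m) (ha : a ∈ unitIdeal m) : f a = 0 := by
  have h : unitIdeal m ≤ RingHom.ker f := by
    refine Ideal.span_le.mpr ?_
    rintro _ ⟨j, rfl⟩
    have h0 : f 0 = 0 := map_zero f
    have h1 : f (coord j [] - 1) = f (coord j []) + (-1 : ℝ) • f 1 := by
      rw [← map_smul, ← map_add, neg_one_smul, sub_eq_add_neg]
    have h2 : f (1 + (-1 : ℝ) • 1) = f 1 + (-1 : ℝ) • f 1 := by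
      rw [map_add, map_smul]
    rw [SetLike.mem_coe, RingHom.mem_ker, h1, hf j, ← map_one f, ← h2, neg_one_smul,
      add_neg_cancel, h0]
  exact h ha

/-- The algebra map out of `𝓗` induced by an algebra map out of `𝓑` sending every `a^j_𝟏`
to `1`. -/
noncomputable def liftH {m : ℕ} {A : Type*} [Semiring A] [Algebra ℝ A] (f : CoordAlg m →ₐ[ℝ] A)
    (hf : ∀ j, f (coord j []) = 1) : FeedbackHopf m →ₐ[ℝ] A :=
  Ideal.Quotient.liftₐ (unitIdeal m) f (lift_condition f hf)

theorem comulB_coord_nil {m : ℕ} (j : Fin m) :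
    comulB m (coord j []) = coord j [] ⊗ₜ[ℝ] coord j [] := by
  simp [comulB, coord, starProd_nil]

/-- The map `𝓑 → 𝓗 ⊗ 𝓗` obtained by projecting the coproduct `Δ` of `𝓑`. -/
noncomputable def comulProj (m : ℕ) :
    CoordAlg m →ₐ[ℝ] FeedbackHopf m ⊗[ℝ] FeedbackHopf m :=
  (Algebra.TensorProduct.map (proj m) (proj m)).comp (comulB m)

theorem comulProj_coord_nil {m : ℕ} (j : Fin m) : comulProj m (coord j []) = 1 := by
  rw [comulProj, AlgHom.comp_apply, comulB_coord_nil, Algebra.TensorProduct.map_tmul,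
    proj_coord_nil]
  rfl

/-- The coproduct of `𝓗` induced by the coproduct `Δ` of `𝓑`. -/
noncomputable def comulH (m : ℕ) :
    FeedbackHopf m →ₐ[ℝ] FeedbackHopf m ⊗[ℝ] FeedbackHopf m :=
  liftH (comulProj m) comulProj_coord_nil

/-- The counit of `𝓗` induced by the counit `ν` of `𝓑`. -/
noncomputable def counitH (m : ℕ) : FeedbackHopf m →ₐ[ℝ] ℝ :=
  liftH (counitB m) fun j => by simp [counitB, coord]

/-- The degree-`n` part of `𝓗`: the image of the degree-`n` part of `𝓑`, where `a^j_η` has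
degree the length of `η`. -/
noncomputable def hopfGrade (m n : ℕ) : Submodule ℝ (FeedbackHopf m) :=
  (MvPolynomial.weightedHomogeneousSubmodule ℝ
    (fun p : Fin m × Word m => p.2.length) n).map (proj m).toLinearMap

/-- `V_n`: the span in `𝓗` of the coordinate functions `a^j_η` with `η` of length `n`. -/
noncomputable def coordSpan (m n : ℕ) : Submodule ℝ (FeedbackHopf m) :=
  Submodule.span ℝ {x | ∃ (j : Fin m) (w : Word m), w.length = n ∧ x = proj m (coord j w)}

/-! ### Graded connected and right-handed bialgebras -/

section Graded

variable {A : Type*} [CommRing A] [Bialgebra ℝ A]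

/-- The image of `P ⊗ Q` in `A ⊗ A`. -/
noncomputable def tensorSub (P Q : Submodule ℝ A) : Submodule ℝ (A ⊗[ℝ] A) :=
  LinearMap.range (TensorProduct.map P.subtype Q.subtype)

/-- `A = ⨁ 𝒜 n` is a graded connected bialgebra. -/
structure IsGradedConnected (𝒜 : ℕ → Submodule ℝ A) : Prop where
  isInternal : DirectSum.IsInternal 𝒜
  one_mem : (1 : A) ∈ 𝒜 0
  mul_mem : ∀ ⦃i j : ℕ⦄ ⦃a b : A⦄, a ∈ 𝒜 i → b ∈ 𝒜 j → a * b ∈ 𝒜 (i + j)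
  comul_mem : ∀ ⦃n : ℕ⦄ ⦃a : A⦄, a ∈ 𝒜 n →
    Coalgebra.comul (R := ℝ) a ∈ ⨆ (i : ℕ) (j : ℕ) (_ : i + j = n), tensorSub (𝒜 i) (𝒜 j)
  counit_eq_zero : ∀ ⦃n : ℕ⦄ ⦃a : A⦄, n ≠ 0 → a ∈ 𝒜 n → Coalgebra.counit (R := ℝ) a = 0
  connected : 𝒜 0 = Submodule.span ℝ {1}

/-- Right-handedness with respect to the generating spaces `V n ⊆ 𝒜 n`: for `n ≥ 1` the reduced
coproduct `Δ(v) - 1 ⊗ v - v ⊗ 1` maps `V n` into the sum of the `V i ⊗ 𝒜 j` with `i + j = n` and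
`i, j ≥ 1`. -/
def IsRightHanded (V 𝒜 : ℕ → Submodule ℝ A) : Prop :=
  ∀ n : ℕ, 1 ≤ n → ∀ v ∈ V n,
    Coalgebra.comul (R := ℝ) v - 1 ⊗ₜ[ℝ] v - v ⊗ₜ[ℝ] 1 ∈
      ⨆ (i : ℕ) (j : ℕ) (_ : i + j = n) (_ : 1 ≤ i) (_ : 1 ≤ j), tensorSub (V i) (𝒜 j)

end Graded

end MultFeedback

open MultFeedback

namespace MultFeedback

/-! ### The shuffle algebra -/

/-! The left derivatives `dL x` are derivations of the shuffle algebra and, together with the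
constant term, determine a series. The map `c ↦ c ↶ d` keeps constant terms, commutes with `dL 0`,
and satisfies `dL k.succ (c ↶ d) = d k ⧢ (dL k.succ c ↶ d)`. So identities can be proved modulo
words of length at least `n`, by induction on `n`, since each derivative uses up one unit of length.
In this way `c ↦ c ↶ d` is a ring endomorphism `mixHom d`, and `mixHom_mixHom` says that composing
two of them corresponds to `⋆`; associativity follows. If `d` has constant terms `1`, its components
have shuffle inverses `e j`, and solving `c j ↶ d = e j` gives `c ⋆ d = 1`.

All this works over any commutative ring and is natural in it. Hence the Hopf axioms are the group
laws for generic tuples with coefficients in tensor powers of `𝓗`, the antipode is read off from the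
inverse of the generic tuple, and characters are its specialisations. The product `c ⋆ d` is linear
in `c`, and `η ↶ d` is `η` plus longer words when `d` has constant terms `1`; this gives
right-handedness.

For the last part, if `H^ι` is nonabelian and `ι` has two elements, any `g ≠ 1` commutes with some
`h ≠ 1` supported in one coordinate, and the centralizer of `h` contains another copy of the
nonabelian `H`. In `M^m` this fails for `g = (1 + z, …, 1 + z)`, `z = x_1 + … + x_m`. A leading term
computation (`exists_letterSum_of_commute`, resting on the injectivity statement
`mem_filt_succ_of_insD`) shows that whatever commutes with an element `1 + t z + …`, `t ≠ 0`, is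
itself `1 + s z + …`, and is trivial if `s = 0`. As `s` is additive under `⋆`, it vanishes on
commutators, so all centralizers in question are abelian. -/

/-- Series, seen as a commutative ring under the shuffle product. -/
def ShuffleAlg (R : Type*) (m : ℕ) : Type _ := Series R m

/-- A series, as an element of the shuffle algebra. -/
def toSh {R : Type*} {m : ℕ} (c : Series R m) : ShuffleAlg R m := c

/-- The coefficient of an element of the shuffle algebra at a word. -/
def coeff {R : Type*} {m : ℕ} (w : Word m) (c : ShuffleAlg R m) : R := c w

@[simp] theorem coeff_toSh {R : Type*} {m : ℕ} (w : Word m) (c : Series R m) : coeff w (toSh c) = c w := rfl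

@[ext] theorem ShuffleAlg.ext {R : Type*} {m : ℕ} {a b : ShuffleAlg R m} (h : ∀ w, coeff w a = coeff w b) : a = b :=
  funext h

/-- The left derivative `x⁻¹ c` of a series. -/
def der {R : Type*} {m : ℕ} (x : Fin (m + 1)) (c : Series R m) : Series R m := fun w => c (x :: w)

theorem series_ext_der {R : Type*} {m : ℕ} {c d : Series R m} (h0 : c [] = d [])
    (h : ∀ x, der x c = der x d) : c = d := by
  funext w
  cases w with
  | nil => exact h0
  | cons x w => exact congrFun (h x) w

section Shuffle

variable {R : Type*} [CommRing R] {m : ℕ}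

theorem shuffle_cons (c d : Series R m) (x : Fin (m + 1)) (w : Word m) :
    shuffle c d (x :: w) = shuffle (der x c) d w + shuffle c (der x d) w := by
  simp [shuffle, unshuffle, der, Function.comp_def]

theorem shuffle_add (a b c : Series R m) : shuffle a (b + c) = shuffle a b + shuffle a c := by
  funext w
  induction w generalizing a b c with
  | nil => simp [shuffle_nil, mul_add]
  | cons x w ih =>
    have h : der x (b + c) = der x b + der x c := rfl
    simp only [shuffle_cons, Pi.add_apply, h, ih]
    ring

theorem shuffle_comm (a b : Series R m) : shuffle a b = shuffle b a := by
  funext w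
  induction w generalizing a b with
  | nil => simp [shuffle_nil, mul_comm]
  | cons x w ih =>
    rw [shuffle_cons, shuffle_cons, ih, ih a, add_comm]

theorem der_shuffle (x : Fin (m + 1)) (c d : Series R m) :
    der x (shuffle c d) = shuffle (der x c) d + shuffle c (der x d) := by
  funext w
  exact shuffle_cons c d x w

theorem add_shuffle (a b c : Series R m) : shuffle (a + b) c = shuffle a c + shuffle b c := by
  rw [shuffle_comm, shuffle_add, shuffle_comm c, shuffle_comm c]

theorem shuffle_assoc (a b c : Series R m) :
    shuffle (shuffle a b) c = shuffle a (shuffle b c) := by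
  funext w
  induction w generalizing a b c with
  | nil => simp [shuffle_nil, mul_assoc]
  | cons x w ih =>
    simp only [shuffle_cons, der_shuffle, add_shuffle, shuffle_add, Pi.add_apply, ih]
    ring

theorem der_unitSeries (x : Fin (m + 1)) : der x (unitSeries : Series R m) = 0 := by
  funext w
  simp [der, unitSeries]

theorem zero_shuffle (a : Series R m) : shuffle 0 a = 0 := by
  funext w
  simp [shuffle]

theorem unitSeries_shuffle (a : Series R m) : shuffle unitSeries a = a := by
  funext w
  induction w generalizing a with
  | nil => simp [shuffle_nil, unitSeries]
  | cons x w ih =>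
    rw [shuffle_cons, der_unitSeries, zero_shuffle, ih]
    simp [der]

noncomputable instance : AddCommGroup (ShuffleAlg R m) :=
  inferInstanceAs (AddCommGroup (Word m → R))

noncomputable instance : CommRing (ShuffleAlg R m) where
  __ := (inferInstance : AddCommGroup (ShuffleAlg R m))
  mul := shuffle
  one := unitSeries
  mul_assoc := shuffle_assoc
  mul_comm := shuffle_comm
  one_mul := unitSeries_shuffle
  mul_one a := (shuffle_comm _ _).trans (unitSeries_shuffle a)
  left_distrib := shuffle_add
  right_distrib := add_shuffle
  zero_mul := zero_shuffle
  mul_zero a := (shuffle_comm _ _).trans (zero_shuffle a)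

@[simp] theorem coeff_add (w : Word m) (a b : ShuffleAlg R m) :
    coeff w (a + b) = coeff w a + coeff w b := rfl

@[simp] theorem coeff_sub (w : Word m) (a b : ShuffleAlg R m) :
    coeff w (a - b) = coeff w a - coeff w b := rfl

@[simp] theorem coeff_zero (w : Word m) : coeff w (0 : ShuffleAlg R m) = 0 := rfl

@[simp] theorem coeff_nil_mul (a b : ShuffleAlg R m) :
    coeff [] (a * b) = coeff [] a * coeff [] b := shuffle_nil a b

@[simp] theorem coeff_nil_one : coeff [] (1 : ShuffleAlg R m) = 1 := rfl

@[simp] theorem coeff_cons_one (x : Fin (m + 1)) (w : Word m) :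
    coeff (x :: w) (1 : ShuffleAlg R m) = 0 := by
  change (unitSeries : Series R m) (x :: w) = 0
  simp [unitSeries]

/-- The left derivative as a derivation of the shuffle algebra. -/
def dL (x : Fin (m + 1)) : ShuffleAlg R m →+ ShuffleAlg R m where
  toFun := der x
  map_zero' := rfl
  map_add' _ _ := rfl

@[simp] theorem coeff_dL (x : Fin (m + 1)) (w : Word m) (a : ShuffleAlg R m) :
    coeff w (dL x a) = coeff (x :: w) a := rfl

theorem dL_mul (x : Fin (m + 1)) (a b : ShuffleAlg R m) :
    dL x (a * b) = dL x a * b + a * dL x b := der_shuffle x a b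

@[simp] theorem dL_one (x : Fin (m + 1)) : dL x (1 : ShuffleAlg R m) = 0 := der_unitSeries x

/-! ### The length filtration -/

theorem coeff_mul_eq_zero {p q : ℕ} {a b : ShuffleAlg R m} (w : Word m)
    (ha : ∀ w : Word m, w.length < p → coeff w a = 0)
    (hb : ∀ w : Word m, w.length < q → coeff w b = 0)
    (hw : w.length < p + q) : coeff w (a * b) = 0 := by
  induction w generalizing a b p q with
  | nil =>
    rw [coeff_nil_mul]
    by_cases hp : 0 < p
    · rw [ha [] hp, zero_mul]
    · rw [hb [] (by simp at hw ⊢; omega), mul_zero]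
  | cons x w ih =>
    rw [List.length_cons] at hw
    rw [← coeff_dL, dL_mul, coeff_add]
    -- Truncated subtraction is harmless: for `p = 0` the vanishing condition is empty before and
    -- after differentiation.
    rw [ih (p := p - 1) (q := q) (fun v hv => ?_) hb (by omega),
      ih (p := p) (q := q - 1) ha (fun v hv => ?_) (by omega), add_zero]
    · exact hb _ (by simp; omega)
    · exact ha _ (by simp; omega)

/-- The ideal of series without terms of length less than `n`. -/
def filt (R : Type*) [CommRing R] (m n : ℕ) : Ideal (ShuffleAlg R m) where
  carrier := {a | ∀ w : Word m, w.length < n → coeff w a = 0}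
  add_mem' ha hb w hw := by rw [coeff_add, ha w hw, hb w hw, add_zero]
  zero_mem' _ _ := rfl
  smul_mem' a b hb w hw :=
    coeff_mul_eq_zero (p := 0) w (fun _ h => absurd h (by simp)) hb (by simpa using hw)

theorem mem_filt_zero (a : ShuffleAlg R m) : a ∈ filt R m 0 := fun _ h => absurd h (by simp)

theorem mem_filt_succ {n : ℕ} {a : ShuffleAlg R m} :
    a ∈ filt R m (n + 1) ↔ coeff [] a = 0 ∧ ∀ x, dL x a ∈ filt R m n := by
  constructor
  · intro h
    exact ⟨h [] (by simp), fun x w hw => h (x :: w) (by simpa using hw)⟩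
  · rintro ⟨h0, h⟩ w hw
    cases w with
    | nil => exact h0
    | cons x w => exact h x w (by simpa using hw)

theorem mul_mem_filt {p q : ℕ} {a b : ShuffleAlg R m} (ha : a ∈ filt R m p)
    (hb : b ∈ filt R m q) : a * b ∈ filt R m (p + q) :=
  fun w hw => coeff_mul_eq_zero w ha hb hw

theorem filt_anti {p q : ℕ} (h : p ≤ q) {a : ShuffleAlg R m} (ha : a ∈ filt R m q) :
    a ∈ filt R m p := fun w hw => ha w (hw.trans_le h)

theorem eq_of_sub_mem_filt {a b : ShuffleAlg R m} (h : ∀ n, a - b ∈ filt R m n) : a = b := by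
  ext w
  have := h (w.length + 1) w (Nat.lt_succ_self _)
  rwa [coeff_sub, sub_eq_zero] at this

/-- Elements of the shuffle algebra with constant term `1` are invertible. -/
theorem exists_mul_eq_one (a : ShuffleAlg R m) (ha : coeff [] a = 1) :
    ∃ b : ShuffleAlg R m, a * b = 1 ∧ coeff [] b = 1 := by
  have hu : 1 - a ∈ filt R m 1 := mem_filt_succ.2 ⟨by simp [ha], fun _ => mem_filt_zero _⟩
  have hpow : ∀ k, (1 - a) ^ k ∈ filt R m k := by
    intro k
    induction k with
    | zero => exact mem_filt_zero _
    | succ k ih => rw [pow_succ]; exact mul_mem_filt ih hu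
  let s : ℕ → ShuffleAlg R m := fun n => ∑ k ∈ Finset.range n, (1 - a) ^ k
  have hs : ∀ n k, s (n + k) - s n ∈ filt R m n := by
    intro n k
    induction k with
    | zero => simp
    | succ k ih =>
      have : s (n + (k + 1)) - s n = (s (n + k) - s n) + (1 - a) ^ (n + k) := by
        rw [← add_assoc]
        simp only [s, Finset.sum_range_succ]
        ring
      rw [this]
      exact add_mem ih (filt_anti (Nat.le_add_right n k) (hpow _))
  -- The partial sums of the geometric series have a stable coefficient at `w` from index `|w| + 1`
  -- on.
  let b : ShuffleAlg R m := toSh fun w => coeff w (s (w.length + 1))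
  have hb : ∀ n, b - s n ∈ filt R m n := by
    intro n w hw
    obtain ⟨k, rfl⟩ := Nat.exists_eq_add_of_lt hw
    have := hs (w.length + 1) k w (Nat.lt_succ_self _)
    rw [coeff_sub, sub_eq_zero] at this ⊢
    rw [add_right_comm, this]
    rfl
  have hgeom : ∀ n, a * s n = 1 - (1 - a) ^ n := by
    intro n
    have := mul_neg_geom_sum (1 - a) n
    rwa [sub_sub_cancel] at this
  have hab : a * b = 1 := by
    refine eq_of_sub_mem_filt fun n => ?_
    have : a * b - 1 = a * (b - s n) - (1 - a) ^ n := by rw [mul_sub, hgeom]; ring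
    rw [this]
    exact sub_mem (Ideal.mul_mem_left _ _ (hb n)) (hpow n)
  refine ⟨b, hab, ?_⟩
  have := congrArg (coeff []) hab
  simpa [ha] using this

end Shuffle

/-! ### The mixed composition -/

section Mixed

variable {R : Type*} [CommRing R] {m : ℕ}

/-- The words of length at most `n`. -/
noncomputable def wordsLE (m n : ℕ) : Finset (Word m) :=
  (List.finite_length_le (α := Fin (m + 1)) (n := n)).toFinset

theorem mem_wordsLE {n : ℕ} {w : Word m} : w ∈ wordsLE m n ↔ w.length ≤ n := by
  simp [wordsLE]

theorem wordMixed_cons_zero (d : Fin m → Series R m) (w : Word m) :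
    wordMixed d (0 :: w) = letterMul 0 (wordMixed d w) := rfl

theorem wordMixed_cons_succ (d : Fin m → Series R m) (k : Fin m) (w : Word m) :
    wordMixed d (k.succ :: w) = letterMul k.succ (shuffle (d k) (wordMixed d w)) := rfl

theorem letterMul_mem_filt {n : ℕ} (x : Fin (m + 1)) {c : Series R m}
    (hc : toSh c ∈ filt R m n) : toSh (letterMul x c) ∈ filt R m (n + 1) := by
  refine mem_filt_succ.2 ⟨rfl, fun y w hw => ?_⟩
  change (if y = x then c w else 0) = 0
  split_ifs
  · exact hc w hw
  · rfl

theorem wordMixed_mem_filt (d : Fin m → Series R m) (η : Word m) :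
    toSh (wordMixed d η) ∈ filt R m η.length := by
  induction η with
  | nil => exact mem_filt_zero _
  | cons x η ih =>
    refine letterMul_mem_filt x ?_
    refine Fin.cases ih (fun k => ?_) x
    exact Ideal.mul_mem_left _ (toSh (d k)) ih

theorem mixed_eq_sum (c : Series R m) (d : Fin m → Series R m) {w : Word m} {n : ℕ}
    (hw : w.length ≤ n) : mixed c d w = ∑ η ∈ wordsLE m n, c η * wordMixed d η w := by
  refine finsum_eq_sum_of_support_subset _ fun η hη => ?_
  rw [Finset.mem_coe, mem_wordsLE]
  by_contra h
  refine hη ?_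
  have := wordMixed_mem_filt d η w (by omega)
  rw [coeff_toSh] at this
  simp only [this, mul_zero]

theorem shuffle_sum {ι : Type*} (s : Finset ι) (a : Series R m) (f : ι → Series R m) :
    shuffle a (∑ i ∈ s, f i) = ∑ i ∈ s, shuffle a (f i) :=
  Finset.mul_sum (R := ShuffleAlg R m) s f a

theorem smul_shuffle (r : R) (a b : Series R m) : shuffle a (r • b) = r • shuffle a b := by
  funext w
  simp only [shuffle, Pi.smul_apply, smul_eq_mul, ← List.sum_map_mul_left]
  congr 2
  funext p
  ring

theorem shuffle_congr {a b c : Series R m} {n : ℕ} (h : ∀ w : Word m, w.length < n → b w = c w)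
    {w : Word m} (hw : w.length < n) : shuffle a b w = shuffle a c w := by
  have h1 : toSh b - toSh c ∈ filt R m n := fun v hv => by
    rw [coeff_sub, coeff_toSh, coeff_toSh, h v hv, sub_self]
  have h2 := Ideal.mul_mem_left _ (toSh a) h1 w hw
  rw [mul_sub, coeff_sub, sub_eq_zero] at h2
  exact h2

/-- A word composed with `d` keeps its first letter, so only words beginning with `x` contribute. -/
theorem mixed_cons_aux (c : Series R m) (d : Fin m → Series R m) (x : Fin (m + 1)) (w : Word m) :
    mixed c d (x :: w) = ∑ᶠ η : Word m, c (x :: η) * wordMixed d (x :: η) (x :: w) := by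
  unfold mixed
  have hinj : Function.Injective (fun η : Word m => x :: η) := fun _ _ h => (List.cons.inj h).2
  rw [← finsum_mem_range (f := fun η => c η * wordMixed d η (x :: w)) hinj,
    ← finsum_mem_univ]
  refine finsum_mem_inter_support_eq' _ _ _ fun η hη => ?_
  cases η with
  | nil => exact absurd (by simp [wordMixed, unitSeries]) hη
  | cons y η =>
    simp only [Set.mem_univ, Set.mem_range, List.cons.injEq, true_iff]
    refine ⟨η, ?_, rfl⟩
    by_contra h
    exact hη (by simp [wordMixed, letterMul, h])

theorem der_zero_mixed (c : Series R m) (d : Fin m → Series R m) :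
    der 0 (mixed c d) = mixed (der 0 c) d := by
  funext w
  change mixed c d (0 :: w) = _
  rw [mixed_cons_aux]
  unfold mixed
  refine finsum_congr fun η => ?_
  rw [wordMixed_cons_zero]
  simp [letterMul, der]

theorem der_succ_mixed (c : Series R m) (d : Fin m → Series R m) (k : Fin m) :
    der k.succ (mixed c d) = shuffle (d k) (mixed (der k.succ c) d) := by
  funext w
  change mixed c d (k.succ :: w) = _
  rw [mixed_cons_aux]
  -- Up to length `|w|` the infinite sum may be truncated, and a finite sum passes through the
  -- shuffle product.
  have h1 : ∀ v : Word m, v.length < w.length + 1 → mixed (der k.succ c) d v =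
      (∑ η ∈ wordsLE m w.length, der k.succ c η • wordMixed d η) v := fun v hv => by
    rw [mixed_eq_sum _ _ (Nat.le_of_lt_succ hv)]
    simp
  rw [shuffle_congr h1 (Nat.lt_succ_self _), shuffle_sum, Finset.sum_apply,
    finsum_eq_sum_of_support_subset (s := wordsLE m w.length)]
  · refine Finset.sum_congr rfl fun η _ => ?_
    rw [wordMixed_cons_succ, smul_shuffle]
    simp [letterMul, der]
  · intro η hη
    rw [Finset.mem_coe, mem_wordsLE]
    by_contra h
    refine hη ?_
    have := wordMixed_mem_filt d (k.succ :: η) (k.succ :: w) (by simp; omega)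
    rw [coeff_toSh] at this
    simp only [this, mul_zero]

/-- The mixed composition on the shuffle algebra. -/
noncomputable def mix (d : Fin m → ShuffleAlg R m) (c : ShuffleAlg R m) : ShuffleAlg R m :=
  mixed c d

@[simp] theorem coeff_nil_mix (d : Fin m → ShuffleAlg R m) (c : ShuffleAlg R m) :
    coeff [] (mix d c) = coeff [] c := mixed_nil c d

theorem dL_zero_mix (d : Fin m → ShuffleAlg R m) (c : ShuffleAlg R m) :
    dL 0 (mix d c) = mix d (dL 0 c) := der_zero_mixed c d

theorem dL_succ_mix (d : Fin m → ShuffleAlg R m) (c : ShuffleAlg R m) (k : Fin m) :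
    dL k.succ (mix d c) = d k * mix d (dL k.succ c) := der_succ_mixed c d k

/-- Induction along left derivatives for series congruent modulo the filtration. -/
theorem mem_filt_succ' {n : ℕ} {a : ShuffleAlg R m} (h : coeff [] a = 0)
    (h0 : dL 0 a ∈ filt R m n) (hs : ∀ k : Fin m, dL k.succ a ∈ filt R m n) :
    a ∈ filt R m (n + 1) :=
  mem_filt_succ.2 ⟨h, fun x => Fin.cases h0 hs x⟩

theorem mix_one (d : Fin m → ShuffleAlg R m) : mix d 1 = 1 := by
  have h0 : mix d 0 = 0 := by
    refine ShuffleAlg.ext fun w => ?_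
    change mixed 0 d w = 0
    simp [mixed]
  refine series_ext_der ?_ fun x => ?_
  · exact coeff_nil_mix d 1
  · refine Fin.cases ?_ (fun k => ?_) x
    · change dL 0 (mix d 1) = dL 0 1
      rw [dL_zero_mix, dL_one, h0]
    · change dL _ (mix d 1) = dL _ 1
      rw [dL_succ_mix, dL_one, h0, mul_zero]

theorem mix_add (d : Fin m → ShuffleAlg R m) (a b : ShuffleAlg R m) :
    mix d (a + b) = mix d a + mix d b := by
  refine eq_of_sub_mem_filt fun n => ?_
  induction n generalizing a b with
  | zero => exact mem_filt_zero _
  | succ n ih =>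
    refine mem_filt_succ' (by simp) ?_ fun k => ?_
    · simp only [map_sub, map_add, dL_zero_mix]
      exact ih _ _
    · have : dL k.succ (mix d (a + b) - (mix d a + mix d b)) =
          d k * (mix d (dL k.succ a + dL k.succ b) -
            (mix d (dL k.succ a) + mix d (dL k.succ b))) := by
        simp only [map_sub, map_add, dL_succ_mix]
        ring
      rw [this]
      exact Ideal.mul_mem_left _ _ (ih _ _)

/-- The Leibniz rule splits the derivative of the defect into two defects of the same kind,
multiplied by `d k` when the letter is `x_k`. -/
theorem mix_mul (d : Fin m → ShuffleAlg R m) (a b : ShuffleAlg R m) :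
    mix d (a * b) = mix d a * mix d b := by
  refine eq_of_sub_mem_filt fun n => ?_
  induction n generalizing a b with
  | zero => exact mem_filt_zero _
  | succ n ih =>
    refine mem_filt_succ' (by simp) ?_ fun k => ?_
    · have : dL 0 (mix d (a * b) - mix d a * mix d b) =
          (mix d (dL 0 a * b) - mix d (dL 0 a) * mix d b) +
          (mix d (a * dL 0 b) - mix d a * mix d (dL 0 b)) := by
        simp only [map_sub, dL_mul, dL_zero_mix, mix_add]
        ring
      rw [this]
      exact add_mem (ih _ _) (ih _ _)
    · have : dL k.succ (mix d (a * b) - mix d a * mix d b) =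
          d k * ((mix d (dL k.succ a * b) - mix d (dL k.succ a) * mix d b) +
          (mix d (a * dL k.succ b) - mix d a * mix d (dL k.succ b))) := by
        simp only [map_sub, dL_mul, dL_succ_mix, mix_add]
        ring
      rw [this]
      exact Ideal.mul_mem_left _ _ (add_mem (ih _ _) (ih _ _))

/-- The mixed composition `c ↦ c ↶ d`, an endomorphism of the shuffle algebra. -/
noncomputable def mixHom (d : Fin m → ShuffleAlg R m) : ShuffleAlg R m →+* ShuffleAlg R m where
  toFun := mix d
  map_one' := mix_one d
  map_mul' := mix_mul d
  map_zero' := by simpa using mix_add d 0 0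
  map_add' := mix_add d

@[simp] theorem coeff_nil_mixHom (d : Fin m → ShuffleAlg R m) (c : ShuffleAlg R m) :
    coeff [] (mixHom d c) = coeff [] c := mixed_nil c d

theorem dL_zero_mixHom (d : Fin m → ShuffleAlg R m) (c : ShuffleAlg R m) :
    dL 0 (mixHom d c) = mixHom d (dL 0 c) := der_zero_mixed c d

theorem dL_succ_mixHom (d : Fin m → ShuffleAlg R m) (c : ShuffleAlg R m) (k : Fin m) :
    dL k.succ (mixHom d c) = d k * mixHom d (dL k.succ c) := der_succ_mixed c d k

/-- The composition product on tuples in the shuffle algebra. -/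
noncomputable def star (c d : Fin m → ShuffleAlg R m) : Fin m → ShuffleAlg R m :=
  fun j => d j * mixHom d (c j)

/-- Both sides obey the same recursion: differentiating the left side by `x_k` produces the factor
`d k * mixHom d (c k)`, which is `star c d k`. -/
theorem mixHom_mixHom (c d : Fin m → ShuffleAlg R m) (a : ShuffleAlg R m) :
    mixHom d (mixHom c a) = mixHom (star c d) a := by
  refine eq_of_sub_mem_filt fun n => ?_
  induction n generalizing a with
  | zero => exact mem_filt_zero _
  | succ n ih =>
    refine mem_filt_succ' (by simp) ?_ fun k => ?_
    · simp only [map_sub, dL_zero_mixHom]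
      exact ih _
    · have : dL k.succ (mixHom d (mixHom c a) - mixHom (star c d) a) =
          star c d k * (mixHom d (mixHom c (dL k.succ a)) - mixHom (star c d) (dL k.succ a)) := by
        simp only [map_sub, dL_succ_mixHom, map_mul, star]
        ring
      rw [this]
      exact Ideal.mul_mem_left _ _ (ih _)

theorem star_assoc (c d e : Fin m → ShuffleAlg R m) :
    star (star c d) e = star c (star d e) := by
  funext j
  have := mixHom_mixHom d e (c j)
  simp only [star, map_mul] at this ⊢
  rw [this]
  ring

theorem mixHom_one_tuple (a : ShuffleAlg R m) : mixHom (1 : Fin m → ShuffleAlg R m) a = a := by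
  refine eq_of_sub_mem_filt fun n => ?_
  induction n generalizing a with
  | zero => exact mem_filt_zero _
  | succ n ih =>
    refine mem_filt_succ' (by simp) ?_ fun k => ?_
    · simp only [map_sub, dL_zero_mixHom]
      exact ih _
    · simp only [map_sub, dL_succ_mixHom, Pi.one_apply, one_mul]
      exact ih _

theorem star_one (c : Fin m → ShuffleAlg R m) : star c 1 = c := by
  funext j
  simp [star, mixHom_one_tuple]

theorem one_star (d : Fin m → ShuffleAlg R m) : star 1 d = d := by
  funext j
  simp [star]

/-! ### Inverses -/

/-- The series `c` with `c ↶ d = b`, given the shuffle inverses `e` of the components of `d`. -/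
noncomputable def unmix (e : Fin m → ShuffleAlg R m) : Word m → ShuffleAlg R m → R
  | [], b => coeff [] b
  | x :: w, b => unmix e w
      (Fin.cases (motive := fun _ => ShuffleAlg R m) (dL 0 b) (fun k => e k * dL k.succ b) x)

/-- Multiplying by `e k` solves the recursion for the derivative of the unknown series; `unmix`
iterates this. -/
theorem mixHom_surjective {d e : Fin m → ShuffleAlg R m} (h : ∀ k, d k * e k = 1)
    (b : ShuffleAlg R m) : mixHom d (toSh fun w => unmix e w b) = b := by
  refine eq_of_sub_mem_filt fun n => ?_
  induction n generalizing b with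
  | zero => exact mem_filt_zero _
  | succ n ih =>
    refine mem_filt_succ' (by simp [unmix]) ?_ fun k => ?_
    · rw [map_sub, dL_zero_mixHom]
      exact ih (dL 0 b)
    · have h1 : dL k.succ (toSh fun w => unmix e w b) =
          toSh fun w => unmix e w (e k * dL k.succ b) := rfl
      have : dL k.succ (mixHom d (toSh fun w => unmix e w b) - b) =
          d k * (mixHom d (toSh fun w => unmix e w (e k * dL k.succ b)) -
            e k * dL k.succ b) := by
        rw [mul_sub, ← mul_assoc (d k), h, one_mul, map_sub, dL_succ_mixHom, h1]
      rw [this]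
      exact Ideal.mul_mem_left _ _ (ih _)

theorem exists_star_eq_one (d : Fin m → ShuffleAlg R m) (hd : ∀ j, coeff [] (d j) = 1) :
    ∃ c : Fin m → ShuffleAlg R m, star c d = 1 ∧ ∀ j, coeff [] (c j) = 1 := by
  choose e he he' using fun j => exists_mul_eq_one (d j) (hd j)
  have key : ∀ j, mixHom d (toSh fun w => unmix e w (e j)) = e j :=
    fun j => mixHom_surjective he (e j)
  refine ⟨fun j => toSh fun w => unmix e w (e j), ?_, fun j => ?_⟩
  · funext j
    rw [star, key, he]
    rfl
  · rw [← he' j, ← congrArg (coeff []) (key j), coeff_nil_mixHom]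

/-- In a monoid where every element has a left inverse, left inverses are two-sided. -/
theorem exists_star_inv (d : Fin m → ShuffleAlg R m) (hd : ∀ j, coeff [] (d j) = 1) :
    ∃ c : Fin m → ShuffleAlg R m, star c d = 1 ∧ star d c = 1 ∧ ∀ j, coeff [] (c j) = 1 := by
  obtain ⟨c, hc, hc'⟩ := exists_star_eq_one d hd
  obtain ⟨b, hb, -⟩ := exists_star_eq_one c hc'
  refine ⟨c, hc, ?_, hc'⟩
  have : b = d := by rw [← star_one b, ← hc, ← star_assoc, hb, one_star]
  rwa [this] at hb

/-! ### Naturality in the coefficients -/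

section Map

variable {S : Type*} [CommRing S]

theorem shuffle_map (f : R →+* S) (c d : Series R m) (w : Word m) :
    f (shuffle c d w) = shuffle (fun v => f (c v)) (fun v => f (d v)) w := by
  simp [shuffle, map_list_sum, Function.comp_def]

theorem wordMixed_map (f : R →+* S) (d : Fin m → Series R m) (η w : Word m) :
    f (wordMixed d η w) = wordMixed (fun j v => f (d j v)) η w := by
  induction η generalizing w with
  | nil => simp [wordMixed, unitSeries, apply_ite f]
  | cons x η ih =>
    cases w with
    | nil => simp [wordMixed, letterMul]
    | cons y w =>
      refine Fin.cases ?_ (fun k => ?_) x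
      · simp only [wordMixed_cons_zero, letterMul, apply_ite f, ih, map_zero]
      · simp only [wordMixed_cons_succ, letterMul, apply_ite f, shuffle_map, ih, map_zero]

theorem mixed_map (f : R →+* S) (c : Series R m) (d : Fin m → Series R m) (w : Word m) :
    f (mixed c d w) = mixed (fun v => f (c v)) (fun j v => f (d j v)) w := by
  simp only [mixed_eq_sum _ _ le_rfl, map_sum, map_mul, wordMixed_map]

theorem starProd_map (f : R →+* S) (c d : Fin m → Series R m) (j : Fin m) (w : Word m) :
    f (starProd c d j w) = starProd (fun j v => f (c j v)) (fun j v => f (d j v)) j w := by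
  simp only [starProd, shuffle_map, mixed_map]

end Map

end Mixed

/-! ### The Hopf algebra of coordinate functions -/

section Hopf

theorem starProd_assoc {R : Type*} [CommRing R] {m : ℕ} (c d e : Fin m → Series R m) :
    starProd (starProd c d) e = starProd c (starProd d e) := star_assoc (R := R) c d e

theorem unitSeries_starProd {R : Type*} [CommRing R] {m : ℕ} (d : Fin m → Series R m) :
    starProd (fun _ => unitSeries) d = d := one_star (R := R) d

theorem starProd_unitSeries {R : Type*} [CommRing R] {m : ℕ} (c : Fin m → Series R m) :
    starProd c (fun _ => unitSeries) = c := star_one (R := R) c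

variable {m : ℕ}

theorem evalAt₂_comulB_coord (c d : Fin m → Series ℝ m) (j : Fin m) (w : Word m) :
    evalAt₂ c d (comulB m (coord j w)) = starProd c d j w := by
  rw [comulB, coord, MvPolynomial.aeval_X]
  change (evalAt₂ c d).toRingHom _ = _
  rw [starProd_map]
  simp [evalAt₂, evalAt, coord]

/-- The class of the coordinate function `a^j_η` in `𝓗`. -/
noncomputable def hcoord (j : Fin m) (w : Word m) : FeedbackHopf m := proj m (coord j w)

theorem hcoord_nil (j : Fin m) : hcoord j ([] : Word m) = 1 := proj_coord_nil j

theorem feedbackHopf_algHom_ext {A : Type*} [Semiring A] [Algebra ℝ A]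
    {f g : FeedbackHopf m →ₐ[ℝ] A} (h : ∀ j w, f (hcoord j w) = g (hcoord j w)) : f = g := by
  refine Ideal.Quotient.algHom_ext ℝ ?_
  refine MvPolynomial.algHom_ext fun p => ?_
  exact h p.1 p.2

theorem liftH_hcoord {A : Type*} [Semiring A] [Algebra ℝ A] (f : CoordAlg m →ₐ[ℝ] A)
    (hf : ∀ j, f (coord j []) = 1) (j : Fin m) (w : Word m) :
    liftH f hf (hcoord j w) = f (coord j w) := rfl

theorem comulH_hcoord (j : Fin m) (w : Word m) :
    comulH m (hcoord j w) = starProd (R := FeedbackHopf m ⊗[ℝ] FeedbackHopf m)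
      (fun j w => hcoord j w ⊗ₜ[ℝ] 1) (fun j w => 1 ⊗ₜ[ℝ] hcoord j w) j w := by
  rw [comulH, liftH_hcoord, comulProj, AlgHom.comp_apply, comulB, coord, MvPolynomial.aeval_X]
  change (Algebra.TensorProduct.map (proj m) (proj m)).toRingHom _ = _
  rw [starProd_map]
  simp [hcoord]

/-- By naturality, any algebra map out of `𝓗 ⊗ 𝓗` turns the coproduct into a `⋆`-product of
specialised generic tuples. Every Hopf axiom is checked through this. -/
theorem algHom_comulH_hcoord {A : Type*} [CommRing A] [Algebra ℝ A]
    (f : FeedbackHopf m ⊗[ℝ] FeedbackHopf m →ₐ[ℝ] A) (j : Fin m) (w : Word m) :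
    f (comulH m (hcoord j w)) = starProd (fun j w => f (hcoord j w ⊗ₜ[ℝ] 1))
      (fun j w => f (1 ⊗ₜ[ℝ] hcoord j w)) j w := by
  rw [comulH_hcoord]
  exact starProd_map f.toRingHom _ _ j w

theorem counitH_hcoord (j : Fin m) (w : Word m) :
    counitH m (hcoord j w) = unitSeries w := by
  rw [counitH, liftH_hcoord, counitB, coord, MvPolynomial.aeval_X]
  rfl

/-- On generators the two sides are `(c ⋆ d) ⋆ e` and `c ⋆ (d ⋆ e)` for the three generic tuples
over `𝓗 ⊗ 𝓗 ⊗ 𝓗`. -/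
theorem comulH_coassoc (m : ℕ) :
    (Algebra.TensorProduct.assoc ℝ ℝ ℝ (FeedbackHopf m) (FeedbackHopf m)
        (FeedbackHopf m)).toAlgHom.comp
      ((Algebra.TensorProduct.map (comulH m) (.id ℝ (FeedbackHopf m))).comp (comulH m)) =
    (Algebra.TensorProduct.map (.id ℝ (FeedbackHopf m)) (comulH m)).comp (comulH m) := by
  refine feedbackHopf_algHom_ext fun j w => ?_
  rw [← AlgHom.comp_assoc, AlgHom.comp_apply, algHom_comulH_hcoord, AlgHom.comp_apply,
    algHom_comulH_hcoord]
  have h1 : ∀ (j : Fin m) (w : Word m),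
      ((Algebra.TensorProduct.assoc ℝ ℝ ℝ (FeedbackHopf m) (FeedbackHopf m)
        (FeedbackHopf m)).toAlgHom.comp
        (Algebra.TensorProduct.map (comulH m) (.id ℝ (FeedbackHopf m)))) (hcoord j w ⊗ₜ[ℝ] 1) =
      starProd (R := FeedbackHopf m ⊗[ℝ] (FeedbackHopf m ⊗[ℝ] FeedbackHopf m))
        (fun j w => hcoord j w ⊗ₜ[ℝ] (1 ⊗ₜ[ℝ] 1))
        (fun j w => 1 ⊗ₜ[ℝ] (hcoord j w ⊗ₜ[ℝ] 1)) j w := fun j w => by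
    have := algHom_comulH_hcoord (((Algebra.TensorProduct.assoc ℝ ℝ ℝ (FeedbackHopf m)
      (FeedbackHopf m) (FeedbackHopf m)).toAlgHom).comp
        (Algebra.TensorProduct.includeLeft : _ →ₐ[ℝ] _)) j w
    simpa using this
  have h2 : ∀ (j : Fin m) (w : Word m),
      (Algebra.TensorProduct.map (.id ℝ (FeedbackHopf m)) (comulH m)) (1 ⊗ₜ[ℝ] hcoord j w) =
      starProd (fun j w => 1 ⊗ₜ[ℝ] (hcoord j w ⊗ₜ[ℝ] 1))
        (fun j w => 1 ⊗ₜ[ℝ] (1 ⊗ₜ[ℝ] hcoord j w)) j w := fun j w => by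
    have := algHom_comulH_hcoord (Algebra.TensorProduct.includeRight :
      _ →ₐ[ℝ] FeedbackHopf m ⊗[ℝ] (FeedbackHopf m ⊗[ℝ] FeedbackHopf m)) j w
    simpa using this
  simp only [h1, h2]
  have h3 := congrFun (congrFun (starProd_assoc
    (R := FeedbackHopf m ⊗[ℝ] (FeedbackHopf m ⊗[ℝ] FeedbackHopf m))
    (fun j w => hcoord j w ⊗ₜ[ℝ] (1 ⊗ₜ[ℝ] 1))
    (fun j w => 1 ⊗ₜ[ℝ] (hcoord j w ⊗ₜ[ℝ] 1))
    (fun j w => 1 ⊗ₜ[ℝ] (1 ⊗ₜ[ℝ] hcoord j w))) j) w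
  convert h3 using 2
  · funext j w
    rw [AlgHom.comp_apply, Algebra.TensorProduct.map_tmul, map_one]
    rfl
  · funext j w
    simp [Algebra.TensorProduct.one_def]

/-- The counit specialises the generic tuple to the unit of `⋆`. -/
theorem counitH_comulH_left (m : ℕ) :
    (Algebra.TensorProduct.map (counitH m) (.id ℝ (FeedbackHopf m))).comp (comulH m) =
      (Algebra.TensorProduct.lid ℝ (FeedbackHopf m)).symm := by
  refine feedbackHopf_algHom_ext fun j w => ?_
  rw [AlgHom.comp_apply, algHom_comulH_hcoord]
  have h : (fun (j : Fin m) (w : Word m) => (Algebra.TensorProduct.map (counitH m)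
      (.id ℝ (FeedbackHopf m))) (hcoord j w ⊗ₜ[ℝ] 1)) = fun _ => unitSeries := by
    funext j w
    rw [Algebra.TensorProduct.map_tmul, counitH_hcoord, map_one]
    unfold unitSeries
    split_ifs
    · rfl
    · rw [TensorProduct.zero_tmul]
  rw [h, unitSeries_starProd]
  simp

theorem counitH_comulH_right (m : ℕ) :
    (Algebra.TensorProduct.map (.id ℝ (FeedbackHopf m)) (counitH m)).comp (comulH m) =
      (Algebra.TensorProduct.rid ℝ ℝ (FeedbackHopf m)).symm := by
  refine feedbackHopf_algHom_ext fun j w => ?_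
  rw [AlgHom.comp_apply, algHom_comulH_hcoord]
  have h : (fun (j : Fin m) (w : Word m) => (Algebra.TensorProduct.map
      (.id ℝ (FeedbackHopf m)) (counitH m)) (1 ⊗ₜ[ℝ] hcoord j w)) = fun _ => unitSeries := by
    funext j w
    rw [Algebra.TensorProduct.map_tmul, counitH_hcoord, map_one]
    unfold unitSeries
    split_ifs
    · rfl
    · rw [TensorProduct.tmul_zero]
  rw [h, starProd_unitSeries]
  simp

/-- `𝓗` has an antipode: the algebra map whose values on generators are the coefficients of the
inverse of the generic tuple. -/
theorem exists_antipode (m : ℕ) : ∃ S : FeedbackHopf m →ₐ[ℝ] FeedbackHopf m,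
    (Algebra.TensorProduct.lift S (.id ℝ _) (fun _ _ => .all _ _)).comp (comulH m) =
      (Algebra.ofId ℝ (FeedbackHopf m)).comp (counitH m) ∧
    (Algebra.TensorProduct.lift (.id ℝ _) S (fun _ _ => .all _ _)).comp (comulH m) =
      (Algebra.ofId ℝ (FeedbackHopf m)).comp (counitH m) := by
  -- The generic tuple over `𝓗` is invertible because its constant terms `a^j_𝟏` have become `1`.
  obtain ⟨s, hs1, hs2, hs0⟩ := exists_star_inv (R := FeedbackHopf m) (m := m)
    (fun j => toSh (hcoord j)) hcoord_nil
  have hu : ∀ (j : Fin m) (w : Word m), algebraMap ℝ (FeedbackHopf m) (unitSeries w) =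
      (1 : Fin m → ShuffleAlg (FeedbackHopf m) m) j w := by
    intro j w
    change _ = (unitSeries : Series (FeedbackHopf m) m) w
    unfold unitSeries
    split_ifs <;> simp
  refine ⟨liftH (MvPolynomial.aeval fun p => coeff p.2 (s p.1)) (fun j => ?_), ?_, ?_⟩
  · rw [coord, MvPolynomial.aeval_X]
    exact hs0 j
  · refine feedbackHopf_algHom_ext fun j w => ?_
    rw [AlgHom.comp_apply, algHom_comulH_hcoord, AlgHom.comp_apply, counitH_hcoord,
      Algebra.ofId_apply, hu j w, ← hs1]
    simp only [Algebra.TensorProduct.lift_tmul, liftH_hcoord, coord, MvPolynomial.aeval_X,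
      map_one, one_mul, mul_one]
    rfl
  · refine feedbackHopf_algHom_ext fun j w => ?_
    rw [AlgHom.comp_apply, algHom_comulH_hcoord, AlgHom.comp_apply, counitH_hcoord,
      Algebra.ofId_apply, hu j w, ← hs2]
    simp only [Algebra.TensorProduct.lift_tmul, liftH_hcoord, coord, MvPolynomial.aeval_X,
      map_one, one_mul, mul_one]
    rfl

/-- Bridges the linear form of the antipode axioms and the equality of algebra maps, which can be
checked on generators. -/
theorem mul'_rTensor {A : Type*} [CommRing A] [Algebra ℝ A] (S : A →ₐ[ℝ] A) (x : A ⊗[ℝ] A) :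
    LinearMap.mul' ℝ A (S.toLinearMap.rTensor A x) =
      Algebra.TensorProduct.lift S (.id ℝ A) (fun _ _ => .all _ _) x := by
  induction x with
  | zero => simp
  | tmul a b => simp
  | add x y hx hy => simp only [map_add, hx, hy]

theorem mul'_lTensor {A : Type*} [CommRing A] [Algebra ℝ A] (S : A →ₐ[ℝ] A) (x : A ⊗[ℝ] A) :
    LinearMap.mul' ℝ A (S.toLinearMap.lTensor A x) =
      Algebra.TensorProduct.lift (.id ℝ A) S (fun _ _ => .all _ _) x := by
  induction x with
  | zero => simp
  | tmul a b => simp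
  | add x y hx hy => simp only [map_add, hx, hy]

/-- Characters of `𝓗` correspond to elements of `M^m`. -/
noncomputable def charEquiv (m : ℕ) : (FeedbackHopf m →ₐ[ℝ] ℝ) ≃ FeedbackGroup m where
  toFun χ := ⟨fun j w => χ (hcoord j w), fun j => by simp only [hcoord_nil, map_one]⟩
  invFun c := liftH (evalAt c.1) fun j => by
    rw [evalAt, coord, MvPolynomial.aeval_X]
    exact c.2 j
  left_inv χ := by
    refine feedbackHopf_algHom_ext fun j w => ?_
    rw [liftH_hcoord, evalAt, coord, MvPolynomial.aeval_X]
  right_inv c := by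
    refine Subtype.ext ?_
    funext j w
    change liftH (evalAt c.1) _ (hcoord j w) = _
    rw [liftH_hcoord, evalAt, coord, MvPolynomial.aeval_X]

/-- Evaluating the two generic tuples at `χ` and `ψ` turns the coproduct into the `⋆`-product of the
corresponding tuples of series. -/
theorem charEquiv_mul (χ ψ : FeedbackHopf m →ₐ[ℝ] ℝ) :
    charEquiv m ((Algebra.TensorProduct.lift χ ψ fun _ _ => .all _ _).comp (comulH m)) =
      charEquiv m χ * charEquiv m ψ := by
  refine Subtype.ext ?_
  funext j w
  change (Algebra.TensorProduct.lift χ ψ fun _ _ => .all _ _) (comulH m (hcoord j w)) =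
    starProd (fun j w => χ (hcoord j w)) (fun j w => ψ (hcoord j w)) j w
  rw [algHom_comulH_hcoord]
  simp

noncomputable instance (m : ℕ) : Bialgebra ℝ (FeedbackHopf m) :=
  Bialgebra.ofAlgHom (comulH m) (counitH m) (comulH_coassoc m) (counitH_comulH_left m)
    (counitH_comulH_right m)

end Hopf

/-! ### The grading -/

section Grading

variable {m : ℕ}

/-- The degree of a monomial in the coordinate functions. -/
noncomputable abbrev monWeight (m : ℕ) : (Fin m × Word m →₀ ℕ) →+ ℕ :=
  Finsupp.weight (fun p : Fin m × Word m => p.2.length)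

theorem hopfGrade_le {n : ℕ} {N : Submodule ℝ (FeedbackHopf m)}
    (h : ∀ v, monWeight m v = n → proj m (MvPolynomial.monomial v 1) ∈ N) :
    hopfGrade m n ≤ N := by
  rintro _ ⟨b, hb, rfl⟩
  have hb' : MvPolynomial.IsWeightedHomogeneous
    (fun p : Fin m × Word m => p.2.length) b n := hb
  rw [b.as_sum, map_sum]
  refine Submodule.sum_mem _ fun v hv => ?_
  have h1 : MvPolynomial.monomial v (b.coeff v) =
      b.coeff v • (MvPolynomial.monomial v (1 : ℝ)) := by
    rw [MvPolynomial.smul_monomial, smul_eq_mul, mul_one]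
  rw [h1, map_smul]
  exact N.smul_mem _ (h v (hb' (MvPolynomial.mem_support_iff.1 hv)))

theorem proj_monomial_mem (v : Fin m × Word m →₀ ℕ) (r : ℝ) :
    proj m (MvPolynomial.monomial v r) ∈ hopfGrade m (monWeight m v) :=
  ⟨_, MvPolynomial.isWeightedHomogeneous_monomial _ v r rfl, rfl⟩

theorem hcoord_mem (j : Fin m) (w : Word m) : hcoord j w ∈ hopfGrade m w.length := by
  have := proj_monomial_mem (Finsupp.single (j, w) 1) 1
  rwa [monWeight, Finsupp.weight_single, one_smul] at this

theorem hopfGrade_mul_mem {i j : ℕ} {a b : FeedbackHopf m} (ha : a ∈ hopfGrade m i)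
    (hb : b ∈ hopfGrade m j) : a * b ∈ hopfGrade m (i + j) := by
  obtain ⟨a, ha, rfl⟩ := ha
  obtain ⟨b, hb, rfl⟩ := hb
  refine ⟨a * b, MvPolynomial.IsWeightedHomogeneous.mul ha hb, ?_⟩
  exact map_mul (proj m) a b

theorem one_mem_hopfGrade : (1 : FeedbackHopf m) ∈ hopfGrade m 0 := by
  have := proj_monomial_mem (0 : Fin m × Word m →₀ ℕ) 1
  rwa [map_zero, MvPolynomial.monomial_zero', map_one, map_one] at this

/-- Induction on monomials for a property compatible with degrees. -/
theorem monomial_induction {P : CoordAlg m → ℕ → Prop} (h1 : P 1 0)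
    (hX : ∀ j w, P (coord j w) w.length)
    (hmul : ∀ a b p q, P a p → P b q → P (a * b) (p + q)) (v : Fin m × Word m →₀ ℕ) :
    P (MvPolynomial.monomial v 1) (monWeight m v) := by
  induction v using Finsupp.induction_linear with
  | zero => simpa using h1
  | add v v' hv hv' =>
    have := hmul _ _ _ _ hv hv'
    rwa [MvPolynomial.monomial_mul, mul_one, ← map_add] at this
  | single p k =>
    rw [← MvPolynomial.X_pow_eq_monomial, monWeight, Finsupp.weight_single]
    induction k with
    | zero => simpa using h1
    | succ k ih =>
      rw [pow_succ, add_smul, one_smul]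
      exact hmul _ _ _ _ ih (hX p.1 p.2)

/-- For a multiplicative family `T`, compatibility of an algebra map with degrees need only be
tested on generators. -/
theorem map_hopfGrade_le {A : Type*} [CommRing A] [Algebra ℝ A] {T : ℕ → Submodule ℝ A}
    (hT1 : 1 ∈ T 0) (hTmul : ∀ i j a b, a ∈ T i → b ∈ T j → a * b ∈ T (i + j))
    (f : FeedbackHopf m →ₐ[ℝ] A) (hf : ∀ j w, f (hcoord j w) ∈ T w.length) {n : ℕ}
    {a : FeedbackHopf m} (ha : a ∈ hopfGrade m n) : f a ∈ T n := by
  have : hopfGrade m n ≤ (T n).comap f.toLinearMap := by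
    refine hopfGrade_le ?_
    rintro v rfl
    refine monomial_induction (P := fun b k => f (proj m b) ∈ T k) ?_ hf ?_ v
    · rwa [map_one, map_one]
    · intro a b p q hp hq
      rw [map_mul, map_mul]
      exact hTmul _ _ _ _ hp hq
  exact this ha

open Polynomial in
/-- The algebra map `𝓗 → 𝓗[t]` with `a^j_η ↦ a^j_η t^|η|`. -/
noncomputable def gradeMap (m : ℕ) : FeedbackHopf m →ₐ[ℝ] (FeedbackHopf m)[X] :=
  liftH (MvPolynomial.aeval fun p => C (hcoord p.1 p.2) * X ^ p.2.length) fun j => by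
    rw [coord, MvPolynomial.aeval_X, hcoord_nil]
    simp

open Polynomial in
theorem gradeMap_hcoord (j : Fin m) (w : Word m) :
    gradeMap m (hcoord j w) = C (hcoord j w) * X ^ w.length := by
  rw [gradeMap, liftH_hcoord, coord, MvPolynomial.aeval_X]

open Polynomial in
theorem gradeMap_of_mem {n : ℕ} {a : FeedbackHopf m} (ha : a ∈ hopfGrade m n) :
    gradeMap m a = C a * X ^ n := by
  have : hopfGrade m n ≤ LinearMap.eqLocus (gradeMap m).toLinearMap
      ((LinearMap.mulRight ℝ (X ^ n : (FeedbackHopf m)[X])).comp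
        (Polynomial.CAlgHom (R := ℝ) (A := FeedbackHopf m)).toLinearMap) := by
    refine hopfGrade_le ?_
    rintro v rfl
    refine monomial_induction (P := fun b k => gradeMap m (proj m b) = C (proj m b) * X ^ k)
      ?_ gradeMap_hcoord ?_ v
    · simp
    · intro a b p q hp hq
      rw [map_mul, map_mul, hp, hq, C_mul]
      ring
  exact this ha

/-- The powers of `t` separate degrees, so homogeneous components can be recovered from the sum;
hence the sum is direct. -/
theorem coeff_gradeMap (x : DirectSum ℕ fun n => hopfGrade m n) (n : ℕ) :
    (gradeMap m (DirectSum.coeAddMonoidHom (hopfGrade m) x)).coeff n = x n := by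
  induction x using DirectSum.induction_on with
  | zero => simp
  | of i a =>
    rw [DirectSum.coeAddMonoidHom_of, gradeMap_of_mem a.2, Polynomial.coeff_C_mul_X_pow]
    split_ifs with h
    · subst h
      rw [DirectSum.of_eq_same]
    · rw [DirectSum.of_eq_of_ne _ _ _ h, ZeroMemClass.coe_zero]
  | add x y hx hy => simp [hx, hy]

theorem isInternal_hopfGrade (m : ℕ) : DirectSum.IsInternal (hopfGrade m) := by
  constructor
  · intro x y h
    refine DFinsupp.ext fun n => Subtype.ext ?_
    exact (coeff_gradeMap x n).symm.trans
      ((congrArg (fun a => (gradeMap m a).coeff n) h).trans (coeff_gradeMap y n))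
  · intro a
    obtain ⟨b, rfl⟩ : ∃ b, proj m b = a := Ideal.Quotient.mk_surjective a
    induction b using MvPolynomial.induction_on' with
    | monomial v r =>
      exact ⟨DirectSum.of (fun n => hopfGrade m n) _ ⟨_, proj_monomial_mem v r⟩, by
        rw [DirectSum.coeAddMonoidHom_of]⟩
    | add p q hp hq =>
      obtain ⟨x, hx⟩ := hp
      obtain ⟨y, hy⟩ := hq
      exact ⟨x + y, by rw [map_add, map_add, hx, hy]⟩

/-- Setting `t = 0` kills every generator of positive degree, exactly as the counit does. -/
theorem counitH_eq_coeff_gradeMap (a : FeedbackHopf m) :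
    algebraMap ℝ (FeedbackHopf m) (counitH m a) = (gradeMap m a).coeff 0 := by
  have : (Algebra.ofId ℝ (FeedbackHopf m)).comp (counitH m) =
      ((Polynomial.aeval (R := FeedbackHopf m) 0).restrictScalars ℝ).comp (gradeMap m) := by
    refine feedbackHopf_algHom_ext fun j w => ?_
    rw [AlgHom.comp_apply, AlgHom.comp_apply, counitH_hcoord, gradeMap_hcoord]
    cases w with
    | nil => simp [unitSeries, hcoord_nil]
    | cons x w => simp [unitSeries]
  have h := DFunLike.congr_fun this a
  rw [Polynomial.coeff_zero_eq_aeval_zero]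
  exact h

theorem counitH_eq_zero {n : ℕ} (hn : n ≠ 0) {a : FeedbackHopf m} (ha : a ∈ hopfGrade m n) :
    counitH m a = 0 := by
  have h := counitH_eq_coeff_gradeMap a
  rw [gradeMap_of_mem ha, Polynomial.coeff_C_mul_X_pow, if_neg hn.symm] at h
  -- The counit is a retraction of the scalars, which removes the `algebraMap`.
  have h2 := congrArg (counitH m) h
  rwa [AlgHom.commutes, map_zero] at h2

theorem hopfGrade_zero (m : ℕ) : hopfGrade m 0 = Submodule.span ℝ {1} := by
  refine le_antisymm (fun a ha => ?_) ?_
  · have h := counitH_eq_coeff_gradeMap a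
    rw [gradeMap_of_mem ha, Polynomial.coeff_C_mul_X_pow, if_pos rfl] at h
    rw [← h, Algebra.algebraMap_eq_smul_one]
    exact Submodule.smul_mem _ _ (Submodule.mem_span_singleton_self 1)
  · rw [Submodule.span_le, Set.singleton_subset_iff]
    exact one_mem_hopfGrade

/-! ### The coproduct of the coordinate functions -/

theorem length_of_mem_unshuffle {α : Type*} {w : List α} {p : List α × List α}
    (h : p ∈ unshuffle w) : p.1.length + p.2.length = w.length := by
  induction w generalizing p with
  | nil =>
    simp only [unshuffle, List.mem_singleton] at h
    simp [h]
  | cons x w ih =>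
    simp only [unshuffle, List.mem_append, List.mem_map] at h
    rcases h with ⟨q, hq, rfl⟩ | ⟨q, hq, rfl⟩
    all_goals
      have := ih hq
      simp only [List.length_cons]
      omega

/-- Here `b` is homogeneous of shifted degree `|w| - n`; `hb0` covers the words for which this would
be negative. -/
theorem shuffle_mem_graded {A : Type*} [CommRing A] [Algebra ℝ A] {T : ℕ → Submodule ℝ A}
    (hTmul : ∀ i j a b, a ∈ T i → b ∈ T j → a * b ∈ T (i + j)) {c b : Series A m} {n : ℕ}
    (hc : ∀ w, c w ∈ T w.length) (hb : ∀ w k, w.length = n + k → b w ∈ T k)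
    (hb0 : ∀ w, w.length < n → b w = 0) (w : Word m) (k : ℕ) (hw : w.length = n + k) :
    shuffle c b w ∈ T k := by
  refine list_sum_mem fun a ha => ?_
  obtain ⟨p, hp, rfl⟩ := List.mem_map.1 ha
  have hl := length_of_mem_unshuffle hp
  rcases lt_or_ge p.2.length n with h | h
  · rw [hb0 _ h, mul_zero]
    exact zero_mem _
  · obtain ⟨i, hi⟩ := Nat.exists_eq_add_of_le h
    have := hTmul _ _ _ _ (hc p.1) (hb p.2 i hi)
    rwa [show p.1.length + i = k by omega] at this

theorem wordMixed_mem_graded {A : Type*} [CommRing A] [Algebra ℝ A] {T : ℕ → Submodule ℝ A}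
    (hT1 : 1 ∈ T 0) (hTmul : ∀ i j a b, a ∈ T i → b ∈ T j → a * b ∈ T (i + j))
    {d : Fin m → Series A m} (hd : ∀ j w, d j w ∈ T w.length) (η w : Word m) (k : ℕ)
    (hw : w.length = η.length + k) : wordMixed d η w ∈ T k := by
  induction η generalizing w k with
  | nil =>
    simp only [wordMixed, unitSeries]
    split_ifs with h
    · subst h
      obtain rfl : k = 0 := by simpa using hw.symm
      exact hT1
    · exact zero_mem _
  | cons x η ih =>
    cases w with
    | nil => simp at hw; omega
    | cons y w =>
      have hw' : w.length = η.length + k := by simp only [List.length_cons] at hw; omega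
      refine Fin.cases ?_ (fun j => ?_) x
      · simp only [wordMixed_cons_zero, letterMul]
        split_ifs
        · exact ih w k hw'
        · exact zero_mem _
      · simp only [wordMixed_cons_succ, letterMul]
        split_ifs
        · exact shuffle_mem_graded hTmul (hd j) ih
            (fun w hw => wordMixed_mem_filt d η w hw) w k hw'
        · exact zero_mem _

/-- A factor with constant term `1` changes `b` only in lengths above its lowest one. -/
theorem coeff_mul_of_length_eq {R : Type*} [CommRing R] {a b : ShuffleAlg R m} {n : ℕ}
    (ha : coeff [] a = 1) (hb : b ∈ filt R m n) {w : Word m} (hw : w.length = n) :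
    coeff w (a * b) = coeff w b := by
  have h1 : a - 1 ∈ filt R m 1 := mem_filt_succ.2 ⟨by simp [ha], fun _ => mem_filt_zero _⟩
  have h2 := mul_mem_filt h1 hb w (by omega)
  rwa [sub_mul, one_mul, coeff_sub, sub_eq_zero] at h2

/-- In lowest length each shuffle by `d j` acts as the identity, so `η ↶ d` starts with `η` itself.
-/
theorem wordMixed_of_length_eq {R : Type*} [CommRing R] {d : Fin m → Series R m}
    (hd : ∀ j, d j [] = 1) (η w : Word m) (hw : w.length = η.length) :
    wordMixed d η w = if w = η then 1 else 0 := by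
  induction η generalizing w with
  | nil => simp [wordMixed, unitSeries]
  | cons x η ih =>
    cases w with
    | nil => simp at hw
    | cons y w =>
      have hw' : w.length = η.length := by simpa using hw
      refine Fin.cases ?_ (fun j => ?_) x
      · simp only [wordMixed_cons_zero, letterMul, ih w hw', List.cons.injEq]
        split_ifs <;> simp_all
      · have := coeff_mul_of_length_eq (a := toSh (d j)) (hd j) (wordMixed_mem_filt d η) hw'
        have h2 : shuffle (d j) (wordMixed d η) w = wordMixed d η w := this
        simp only [wordMixed_cons_succ, letterMul, h2, ih w hw', List.cons.injEq]
        split_ifs <;> simp_all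

/-- The coefficient of `a^j_η` in the coproduct of `a^j_w`. -/
noncomputable def comulCoeff (j : Fin m) (η w : Word m) : FeedbackHopf m :=
  shuffle (hcoord j) (wordMixed hcoord η) w

theorem comulCoeff_mem (j : Fin m) (η w : Word m) (k : ℕ) (hw : w.length = η.length + k) :
    comulCoeff j η w ∈ hopfGrade m k :=
  shuffle_mem_graded (fun _ _ _ _ => hopfGrade_mul_mem) (hcoord_mem j)
    (wordMixed_mem_graded one_mem_hopfGrade (fun _ _ _ _ => hopfGrade_mul_mem) hcoord_mem η)
    (fun w hw => wordMixed_mem_filt hcoord η w hw) w k hw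

theorem comulCoeff_nil (j : Fin m) (w : Word m) : comulCoeff j [] w = hcoord j w := by
  rw [comulCoeff, wordMixed, shuffle_comm, unitSeries_shuffle]

theorem comulCoeff_of_length_eq (j : Fin m) (η w : Word m) (hw : w.length = η.length) :
    comulCoeff j η w = if w = η then 1 else 0 := by
  have := coeff_mul_of_length_eq (a := toSh (hcoord j)) (hcoord_nil j)
    (wordMixed_mem_filt hcoord η) hw
  rw [← wordMixed_of_length_eq hcoord_nil η w hw]
  exact this

/-- Since `c ⋆ d` is linear in `c`, the left tensor factors are single coordinate functions; this is
the source of right-handedness. -/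
theorem comulH_hcoord_eq_sum (j : Fin m) (w : Word m) :
    comulH m (hcoord j w) =
      ∑ η ∈ wordsLE m w.length, hcoord j η ⊗ₜ[ℝ] comulCoeff j η w := by
  rw [comulH_hcoord]
  have h1 : ∀ v : Word m, v.length < w.length + 1 →
      mixed (R := FeedbackHopf m ⊗[ℝ] FeedbackHopf m) (fun w => hcoord j w ⊗ₜ[ℝ] 1)
        (fun j w => 1 ⊗ₜ[ℝ] hcoord j w) v =
      (∑ η ∈ wordsLE m w.length, (hcoord j η ⊗ₜ[ℝ] (1 : FeedbackHopf m)) •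
        wordMixed (R := FeedbackHopf m ⊗[ℝ] FeedbackHopf m)
          (fun j w => 1 ⊗ₜ[ℝ] hcoord j w) η) v := fun v hv => by
    rw [mixed_eq_sum _ _ (Nat.le_of_lt_succ hv)]
    simp
  rw [starProd, shuffle_congr h1 (Nat.lt_succ_self _), shuffle_sum, Finset.sum_apply]
  refine Finset.sum_congr rfl fun η _ => ?_
  rw [smul_shuffle, Pi.smul_apply, smul_eq_mul]
  have h2 : (Algebra.TensorProduct.includeRight :
      FeedbackHopf m →ₐ[ℝ] FeedbackHopf m ⊗[ℝ] FeedbackHopf m).toRingHom (comulCoeff j η w) =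
      shuffle (R := FeedbackHopf m ⊗[ℝ] FeedbackHopf m) (fun w => 1 ⊗ₜ[ℝ] hcoord j w)
        (wordMixed (fun j w => 1 ⊗ₜ[ℝ] hcoord j w) η) w := by
    rw [comulCoeff, shuffle_map]
    simp only [wordMixed_map]
    rfl
  rw [← h2]
  simp

theorem tmul_mem_tensorSub {P Q : Submodule ℝ (FeedbackHopf m)} {a b : FeedbackHopf m}
    (ha : a ∈ P) (hb : b ∈ Q) : a ⊗ₜ[ℝ] b ∈ tensorSub P Q :=
  ⟨⟨a, ha⟩ ⊗ₜ ⟨b, hb⟩, rfl⟩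

/-- The degree `n` part of `𝓗 ⊗ 𝓗`. -/
noncomputable def tensorGrade (m n : ℕ) : Submodule ℝ (FeedbackHopf m ⊗[ℝ] FeedbackHopf m) :=
  ⨆ (i : ℕ) (j : ℕ) (_ : i + j = n), tensorSub (hopfGrade m i) (hopfGrade m j)

theorem tmul_mem_tensorGrade {i j n : ℕ} (h : i + j = n) {a b : FeedbackHopf m}
    (ha : a ∈ hopfGrade m i) (hb : b ∈ hopfGrade m j) : a ⊗ₜ[ℝ] b ∈ tensorGrade m n :=
  Submodule.mem_iSup_of_mem i (Submodule.mem_iSup_of_mem j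
    (Submodule.mem_iSup_of_mem h (tmul_mem_tensorSub ha hb)))

theorem tensorGrade_le {n : ℕ} {N : Submodule ℝ (FeedbackHopf m ⊗[ℝ] FeedbackHopf m)}
    (h : ∀ i j a b, i + j = n → a ∈ hopfGrade m i → b ∈ hopfGrade m j → a ⊗ₜ[ℝ] b ∈ N) :
    tensorGrade m n ≤ N := by
  refine iSup_le fun i => iSup_le fun j => iSup_le fun hij => ?_
  rw [tensorSub, TensorProduct.range_map_eq_span_tmul, Submodule.span_le]
  rintro _ ⟨a, b, rfl⟩
  exact h i j a b hij a.2 b.2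

theorem tensorGrade_mul_mem (p q : ℕ) (x y : FeedbackHopf m ⊗[ℝ] FeedbackHopf m)
    (hx : x ∈ tensorGrade m p) (hy : y ∈ tensorGrade m q) : x * y ∈ tensorGrade m (p + q) := by
  have h : tensorGrade m p ≤ (tensorGrade m (p + q)).comap (LinearMap.mulRight ℝ y) := by
    refine tensorGrade_le fun i j a b hij ha hb => ?_
    have h2 : tensorGrade m q ≤
        (tensorGrade m (p + q)).comap (LinearMap.mulLeft ℝ (a ⊗ₜ[ℝ] b)) := by
      refine tensorGrade_le fun i' j' a' b' hij' ha' hb' => ?_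
      rw [Submodule.mem_comap, LinearMap.mulLeft_apply, Algebra.TensorProduct.tmul_mul_tmul]
      exact tmul_mem_tensorGrade (by omega) (hopfGrade_mul_mem ha ha') (hopfGrade_mul_mem hb hb')
    exact h2 hy
  exact h hx

theorem comulH_mem {n : ℕ} {a : FeedbackHopf m} (ha : a ∈ hopfGrade m n) :
    comulH m a ∈ tensorGrade m n := by
  refine map_hopfGrade_le (T := tensorGrade m) ?_ tensorGrade_mul_mem (comulH m)
    (fun j w => ?_) ha
  · exact tmul_mem_tensorGrade (add_zero 0) one_mem_hopfGrade one_mem_hopfGrade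
  · rw [comulH_hcoord_eq_sum]
    refine Submodule.sum_mem _ fun η hη => ?_
    obtain ⟨k, hk⟩ := Nat.exists_eq_add_of_le (mem_wordsLE.1 hη)
    exact tmul_mem_tensorGrade hk.symm (hcoord_mem j η) (comulCoeff_mem j η w k hk)

theorem isGradedConnected_hopfGrade (m : ℕ) : IsGradedConnected (hopfGrade m) where
  isInternal := isInternal_hopfGrade m
  one_mem := one_mem_hopfGrade
  mul_mem _ _ _ _ := hopfGrade_mul_mem
  comul_mem _ _ := comulH_mem
  counit_eq_zero _ _ hn ha := counitH_eq_zero hn ha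
  connected := hopfGrade_zero m

theorem isRightHanded_coordSpan (m : ℕ) : IsRightHanded (coordSpan m) (hopfGrade m) := by
  intro n hn v hv
  let L : FeedbackHopf m →ₗ[ℝ] FeedbackHopf m ⊗[ℝ] FeedbackHopf m :=
    (comulH m).toLinearMap - TensorProduct.mk ℝ _ _ 1 - (TensorProduct.mk ℝ _ _).flip 1
  change L v ∈ _
  rw [← Submodule.mem_comap]
  refine Submodule.span_le.2 ?_ hv
  rintro _ ⟨j, w, rfl, rfl⟩
  -- The terms `η = []` and `η = w` of the coproduct are precisely `1 ⊗ a^j_w` and `a^j_w ⊗ 1`.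
  have hL : L (proj m (coord j w)) =
      ∑ η ∈ ((wordsLE m w.length).erase []).erase w, hcoord j η ⊗ₜ[ℝ] comulCoeff j η w := by
    have hw : w ≠ [] := by rintro rfl; simp at hn
    have h1 := Finset.sum_erase_add (f := fun η => hcoord j η ⊗ₜ[ℝ] comulCoeff j η w) _
      (mem_wordsLE.2 (Nat.zero_le _) : ([] : Word m) ∈ wordsLE m w.length)
    have h2 := Finset.sum_erase_add (f := fun η => hcoord j η ⊗ₜ[ℝ] comulCoeff j η w) _
      (Finset.mem_erase.2 ⟨hw, mem_wordsLE.2 le_rfl⟩ : w ∈ (wordsLE m w.length).erase [])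
    rw [← h2, ← comulH_hcoord_eq_sum, hcoord_nil, comulCoeff_nil,
      comulCoeff_of_length_eq _ _ _ rfl, if_pos rfl] at h1
    change comulH m (hcoord j w) - 1 ⊗ₜ[ℝ] hcoord j w - hcoord j w ⊗ₜ[ℝ] 1 = _
    rw [← h1, add_sub_cancel_right, add_sub_cancel_right]
  rw [SetLike.mem_coe, Submodule.mem_comap, hL]
  refine Submodule.sum_mem _ fun η hη => ?_
  obtain ⟨hηw, hη⟩ := Finset.mem_erase.1 hη
  obtain ⟨hη0, hη⟩ := Finset.mem_erase.1 hη
  obtain ⟨k, hk⟩ := Nat.exists_eq_add_of_le (mem_wordsLE.1 hη)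
  rcases Nat.eq_zero_or_pos k with rfl | hk0
  -- A word of the same length as `w` but different from it contributes nothing, so the right factor
  -- always has positive degree.
  · rw [comulCoeff_of_length_eq _ _ _ hk, if_neg hηw.symm, TensorProduct.tmul_zero]
    exact zero_mem _
  · refine Submodule.mem_iSup_of_mem η.length (Submodule.mem_iSup_of_mem k
      (Submodule.mem_iSup_of_mem hk.symm (Submodule.mem_iSup_of_mem
        (List.length_pos_of_ne_nil hη0) (Submodule.mem_iSup_of_mem hk0 ?_))))
    exact tmul_mem_tensorSub (Submodule.subset_span ⟨j, η, rfl, rfl⟩) (comulCoeff_mem j η w k hk)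

end Grading

/-! ### Leading terms of commuting elements -/

section Leading

variable {m : ℕ}

/-- The constant series. -/
noncomputable def constS (m : ℕ) (r : ℝ) : ShuffleAlg ℝ m := toSh fun w => if w = [] then r else 0

@[simp] theorem coeff_nil_constS (r : ℝ) : coeff [] (constS m r) = r := rfl

@[simp] theorem dL_constS (x : Fin (m + 1)) (r : ℝ) : dL x (constS m r) = 0 := by
  ext w
  change (if x :: w = [] then r else 0) = 0
  simp

theorem coeff_constS_mul (r : ℝ) (a : ShuffleAlg ℝ m) (w : Word m) :
    coeff w (constS m r * a) = r * coeff w a := by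
  induction w generalizing a with
  | nil => simp
  | cons x w ih => rw [← coeff_dL, dL_mul, dL_constS, zero_mul, zero_add, ih, coeff_dL]

theorem mem_filt_of_constS_mul {n : ℕ} {r : ℝ} (hr : r ≠ 0) {a : ShuffleAlg ℝ m}
    (h : constS m r * a ∈ filt ℝ m n) : a ∈ filt ℝ m n := fun w hw => by
  have := h w hw
  rw [coeff_constS_mul] at this
  exact (mul_eq_zero.1 this).resolve_left hr

theorem constS_add (r s : ℝ) : constS m (r + s) = constS m r + constS m s := by
  ext w
  change (if w = [] then r + s else 0) = (if w = [] then r else 0) + (if w = [] then s else 0)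
  split_ifs <;> simp

theorem constS_one : constS m 1 = 1 := rfl

theorem constS_zero : constS m 0 = 0 := by
  ext w
  change (if w = [] then (0 : ℝ) else 0) = 0
  simp

/-- The series `∑ x_k v_k`, the sum over `1 ≤ k ≤ m`. -/
noncomputable def letterSum (v : Fin m → ShuffleAlg ℝ m) : ShuffleAlg ℝ m :=
  toSh fun w => match w with
    | [] => 0
    | x :: w => coeff w (Fin.cases (motive := fun _ => ShuffleAlg ℝ m) 0 v x)

@[simp] theorem coeff_nil_letterSum (v : Fin m → ShuffleAlg ℝ m) :
    coeff [] (letterSum v) = 0 := rfl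

@[simp] theorem dL_zero_letterSum (v : Fin m → ShuffleAlg ℝ m) : dL 0 (letterSum v) = 0 := rfl

@[simp] theorem dL_succ_letterSum (v : Fin m → ShuffleAlg ℝ m) (k : Fin m) :
    dL k.succ (letterSum v) = v k := rfl

theorem letterSum_mem_filt {n : ℕ} {v : Fin m → ShuffleAlg ℝ m} (hv : ∀ k, v k ∈ filt ℝ m n) :
    letterSum v ∈ filt ℝ m (n + 1) :=
  mem_filt_succ' (by simp) (by simp) (by simpa using hv)

/-- The sum `z` of the letters `x_1, …, x_m`. -/
noncomputable def zS (m : ℕ) : ShuffleAlg ℝ m := letterSum fun _ => 1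

@[simp] theorem coeff_nil_zS : coeff [] (zS m) = 0 := rfl

@[simp] theorem dL_zero_zS : dL 0 (zS m) = 0 := rfl

@[simp] theorem dL_succ_zS (k : Fin m) : dL k.succ (zS m) = 1 := rfl

theorem zS_mem_filt : zS m ∈ filt ℝ m 1 := letterSum_mem_filt fun _ => mem_filt_zero _

/-- The coefficients of `insD`. -/
noncomputable def insCoeff : Word m → ShuffleAlg ℝ m → ℝ
  | [], _ => 0
  | x :: w, f => insCoeff w (dL x f) +
      coeff w (Fin.cases (motive := fun _ => ShuffleAlg ℝ m) 0 (fun _ => zS m * dL x f) x)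

/-- The derivation `D` of the shuffle algebra with `D (x_0 f) = x_0 (D f)` and
`D (x_k f) = x_k (D f + z ⧢ f)`: the derivative of `f ↶ d` at the unit in the direction
`(z, …, z)`. -/
noncomputable def insD (f : ShuffleAlg ℝ m) : ShuffleAlg ℝ m := toSh fun w => insCoeff w f

@[simp] theorem coeff_nil_insD (f : ShuffleAlg ℝ m) : coeff [] (insD f) = 0 := rfl

theorem dL_zero_insD (f : ShuffleAlg ℝ m) : dL 0 (insD f) = insD (dL 0 f) := by
  ext w
  exact add_zero _

theorem dL_succ_insD (f : ShuffleAlg ℝ m) (k : Fin m) :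
    dL k.succ (insD f) = insD (dL k.succ f) + zS m * dL k.succ f := rfl

theorem insD_sub (f g : ShuffleAlg ℝ m) : insD (f - g) = insD f - insD g := by
  refine eq_of_sub_mem_filt fun n => ?_
  induction n generalizing f g with
  | zero => exact mem_filt_zero _
  | succ n ih =>
    refine mem_filt_succ' (by simp) ?_ fun k => ?_
    · simp only [map_sub, dL_zero_insD]
      exact ih _ _
    · have : dL k.succ (insD (f - g) - (insD f - insD g)) =
          insD (dL k.succ f - dL k.succ g) - (insD (dL k.succ f) - insD (dL k.succ g)) := by
        simp only [map_sub, dL_succ_insD]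
        ring
      rw [this]
      exact ih _ _

theorem dL_mem_filt {n : ℕ} {f : ShuffleAlg ℝ m} (hf : f ∈ filt ℝ m (n + 1))
    (x : Fin (m + 1)) : dL x f ∈ filt ℝ m n := (mem_filt_succ.1 hf).2 x

theorem insD_mem_filt {n : ℕ} {f : ShuffleAlg ℝ m} (hf : f ∈ filt ℝ m n) :
    insD f ∈ filt ℝ m (n + 1) := by
  induction n generalizing f with
  | zero => exact mem_filt_succ.2 ⟨by simp, fun _ => mem_filt_zero _⟩
  | succ n ih =>
    refine mem_filt_succ' (by simp) ?_ fun k => ?_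
    · rw [dL_zero_insD]
      exact ih (dL_mem_filt hf 0)
    · rw [dL_succ_insD]
      refine add_mem (ih (dL_mem_filt hf _)) ?_
      have := mul_mem_filt zS_mem_filt (dL_mem_filt hf k.succ)
      rwa [add_comm 1 n] at this

/-- Injectivity of `D + a z ⧢ + b z` on leading terms. -/
theorem mem_filt_succ_of_insD (k₀ : Fin m) (N : ℕ) (a b : ℝ) (ha : 0 < a) (hab : 0 ≤ a + b)
    (hN : N = 0 → 0 < a + b) {f : ShuffleAlg ℝ m} (hf : f ∈ filt ℝ m N)
    (h : insD f + constS m a * (zS m * f) + constS m b * letterSum (fun _ => f) ∈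
      filt ℝ m (N + 2)) : f ∈ filt ℝ m (N + 1) := by
  induction N generalizing a b f with
  | zero =>
    -- The coefficient at the one-letter word `x_{k₀}` is `(a + b)` times the constant term of `f`.
    have h1 := (mem_filt_succ.1 (dL_mem_filt h k₀.succ)).1
    simp only [map_add, dL_mul, dL_succ_insD, dL_constS, dL_succ_zS, dL_succ_letterSum,
      coeff_add, coeff_nil_mul, coeff_nil_constS, coeff_nil_zS, coeff_nil_insD,
      zero_mul, zero_add, one_mul, add_zero] at h1
    have h2 : (a + b) * coeff [] f = 0 := by linarith
    exact mem_filt_succ.2 ⟨(mul_eq_zero.1 h2).resolve_left (hN rfl).ne', fun _ => mem_filt_zero _⟩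
  | succ N ih =>
    -- The derivative by `x_0` kills `z` and the letter sum, so the parameters become `(a, 0)`.
    have h0 : dL 0 f ∈ filt ℝ m (N + 1) := by
      refine ih a 0 ha (by linarith) (fun _ => by linarith) (dL_mem_filt hf 0) ?_
      have := dL_mem_filt h 0
      rw [constS_zero, zero_mul, add_zero]
      simpa only [map_add, dL_mul, dL_zero_insD, dL_constS, dL_zero_zS, dL_zero_letterSum,
        zero_mul, zero_add, mul_zero, add_zero] using this
    have hk : ∀ k : Fin m, insD (dL k.succ f) + constS m (a + 1) * (zS m * dL k.succ f) +
        constS m (a + b) * f ∈ filt ℝ m (N + 2) := by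
      intro k
      have := dL_mem_filt h k.succ
      simp only [map_add, dL_mul, dL_succ_insD, dL_constS, dL_succ_zS, dL_succ_letterSum,
        zero_mul, zero_add, one_mul] at this
      convert this using 1
      simp only [constS_add, constS_one]
      ring
    -- Subtracting two of the relations `hk` cancels the common term in `f` and leaves parameters
    -- `(a + 1, 0)`.
    have hkl : ∀ k : Fin m, dL k.succ f - dL k₀.succ f ∈ filt ℝ m (N + 1) := by
      intro k
      refine ih (a + 1) 0 (by linarith) (by linarith) (fun _ => by linarith)
        (sub_mem (dL_mem_filt hf _) (dL_mem_filt hf _)) ?_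
      have := sub_mem (hk k) (hk k₀)
      convert this using 1
      rw [insD_sub, constS_zero]
      ring
    have hz : f - letterSum (fun _ => dL k₀.succ f) ∈ filt ℝ m (N + 2) := by
      refine mem_filt_succ' ?_ ?_ fun k => ?_
      · rw [coeff_sub, coeff_nil_letterSum, sub_zero]
        exact hf [] (by simp)
      · simpa using h0
      · simpa using hkl k
    -- Now `f` is, to leading order, the letter sum of its derivative by `x_{k₀}`; substituting this
    -- into `hk` gives parameters `(a + 1, a + b)`, whose sum is positive.
    have hk0 : dL k₀.succ f ∈ filt ℝ m (N + 1) := by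
      refine ih (a + 1) (a + b) (by linarith) (by linarith) (fun _ => by linarith)
        (dL_mem_filt hf _) ?_
      have := sub_mem (hk k₀) (Ideal.mul_mem_left _ (constS m (a + b)) hz)
      convert this using 1
      ring
    refine mem_filt_succ' (hf [] (by simp)) h0 fun k => ?_
    have := add_mem (hkl k) hk0
    rwa [sub_add_cancel] at this

/-- Every word of `z ⧢ f` contains a letter other than `x_0`. -/
theorem coeff_replicate_zS_mul (N : ℕ) (f : ShuffleAlg ℝ m) :
    coeff (List.replicate N 0) (zS m * f) = 0 := by
  induction N generalizing f with
  | zero => simp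
  | succ N ih =>
    rw [List.replicate_succ, ← coeff_dL, dL_mul, dL_zero_zS, zero_mul, zero_add, ih]

theorem coeff_replicate_insD (N : ℕ) (f : ShuffleAlg ℝ m) :
    coeff (List.replicate N 0) (insD f) = 0 := by
  induction N generalizing f with
  | zero => simp
  | succ N ih => rw [List.replicate_succ, ← coeff_dL, dL_zero_insD, ih]

theorem mem_filt_succ_of_insD_add (k₀ : Fin m) (N : ℕ) {f : ShuffleAlg ℝ m}
    (hf : f ∈ filt ℝ m N) (h : insD f + zS m * f ∈ filt ℝ m (N + 2)) : f ∈ filt ℝ m (N + 1) := by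
  refine mem_filt_succ_of_insD k₀ N 1 0 one_pos (by norm_num) (fun _ => by norm_num) hf ?_
  rwa [constS_one, constS_zero, one_mul, zero_mul, add_zero]

/-- The leading part of an element of the kernel of `D` is a multiple of a power of `x_0`. -/
theorem mem_filt_succ_of_insD_mem (k₀ : Fin m) (N : ℕ) {f : ShuffleAlg ℝ m}
    (hf : f ∈ filt ℝ m N) (h : insD f ∈ filt ℝ m (N + 2))
    (h0 : coeff (List.replicate N 0) f = 0) : f ∈ filt ℝ m (N + 1) := by
  induction N generalizing f with
  | zero => exact mem_filt_succ.2 ⟨h0, fun _ => mem_filt_zero _⟩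
  | succ N ih =>
    refine mem_filt_succ' (hf [] (by simp)) ?_ fun k => ?_
    · refine ih (dL_mem_filt hf 0) ?_ h0
      rw [← dL_zero_insD]
      exact dL_mem_filt h 0
    · refine mem_filt_succ_of_insD_add k₀ N (dL_mem_filt hf _) ?_
      rw [← dL_succ_insD]
      exact dL_mem_filt h k.succ

/-- The centralizer of `(z, …, z)` in the graded Lie algebra is spanned by `(z, …, z)`. -/
theorem exists_letterSum_of_commute (k₀ : Fin m) (n : ℕ) {v : Fin m → ShuffleAlg ℝ m}
    (hv : ∀ j, v j ∈ filt ℝ m (n + 1))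
    (h : ∀ j, letterSum v - insD (v j) ∈ filt ℝ m (n + 3)) :
    ∃ f : ShuffleAlg ℝ m, (∀ j, v j - letterSum (fun _ => f) ∈ filt ℝ m (n + 2)) ∧
      (n ≠ 0 → f ∈ filt ℝ m (n + 1)) := by
  have hs : ∀ j k, v k - (insD (dL k.succ (v j)) + zS m * dL k.succ (v j)) ∈
      filt ℝ m (n + 2) := by
    intro j k
    have := dL_mem_filt (h j) k.succ
    rwa [map_sub, dL_succ_letterSum, dL_succ_insD] at this
  -- To leading order this derivative lies in the kernel of `D`, so it is a multiple of `x_0^n`. The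
  -- multiple is zero because `hs` expresses `v j` by terms without pure powers of `x_0`.
  have h0 : ∀ j, dL 0 (v j) ∈ filt ℝ m (n + 1) := by
    intro j
    refine mem_filt_succ_of_insD_mem k₀ n (dL_mem_filt (hv j) 0) ?_ ?_
    · have := dL_mem_filt (h j) 0
      rwa [map_sub, dL_zero_letterSum, zero_sub, neg_mem_iff, dL_zero_insD] at this
    · have := hs j j (List.replicate (n + 1) 0) (by simp)
      rw [coeff_sub, coeff_add, coeff_replicate_insD, coeff_replicate_zS_mul] at this
      simpa [List.replicate_succ] using this
  -- Injectivity of `D + z ⧢ ·` on leading terms. With `k = k'` the assumption is trivial, so the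
  -- derivatives do not depend on the component; this makes all `v j` agree, and then the letter
  -- does not matter either.
  have hd : ∀ j k j' k', v k - v k' ∈ filt ℝ m (n + 2) →
      dL k.succ (v j) - dL k'.succ (v j') ∈ filt ℝ m (n + 1) := by
    intro j k j' k' hkk
    refine mem_filt_succ_of_insD_add k₀ n
      (sub_mem (dL_mem_filt (hv j) _) (dL_mem_filt (hv j') _)) ?_
    have := add_mem (sub_mem (hs j' k') (hs j k)) hkk
    convert this using 1
    rw [insD_sub]
    ring
  have hvv : ∀ j l, v j - v l ∈ filt ℝ m (n + 2) := by
    intro j l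
    refine mem_filt_succ' ?_ ?_ fun k => ?_
    · rw [coeff_sub, hv j [] (by simp), hv l [] (by simp), sub_zero]
    · rw [map_sub]
      exact sub_mem (h0 j) (h0 l)
    · rw [map_sub]
      refine hd _ _ _ _ ?_
      rw [sub_self]
      exact zero_mem _
  have hz : ∀ j, v j - letterSum (fun _ => dL k₀.succ (v k₀)) ∈ filt ℝ m (n + 2) := by
    intro j
    refine mem_filt_succ' ?_ ?_ fun k => ?_
    · rw [coeff_sub, hv j [] (by simp), coeff_nil_letterSum, sub_zero]
    · simpa using h0 j
    · rw [map_sub, dL_succ_letterSum]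
      exact hd _ _ _ _ (hvv _ _)
  refine ⟨dL k₀.succ (v k₀), hz, fun hn => ?_⟩
  -- Comparing the two expressions for `v k₀` gives `D f + z ⧢ f - ∑ x_k f ≈ 0`. Here `a + b = 0`,
  -- so degree zero must be excluded: it is the surviving direction `(z, …, z)`.
  refine mem_filt_succ_of_insD k₀ n 1 (-1) one_pos (by norm_num) (fun h => absurd h hn)
    (dL_mem_filt (hv k₀) _) ?_
  have := sub_mem (hz k₀) (hs k₀ k₀)
  convert this using 1
  have h1 : constS m (-1) = -1 := by
    have := constS_add (m := m) (-1) 1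
    rw [neg_add_cancel, constS_zero, constS_one] at this
    exact eq_neg_of_add_eq_zero_left this.symm
  rw [h1, constS_one]
  ring

/-! ### First-order expansion of the commutation relation -/

theorem mixHom_mem_filt {n : ℕ} (d : Fin m → ShuffleAlg ℝ m) {a : ShuffleAlg ℝ m}
    (ha : a ∈ filt ℝ m n) : mixHom d a ∈ filt ℝ m n := by
  induction n generalizing a with
  | zero => exact mem_filt_zero _
  | succ n ih =>
    refine mem_filt_succ' ?_ ?_ fun k => ?_
    · rw [coeff_nil_mixHom]
      exact ha [] (by simp)
    · rw [dL_zero_mixHom]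
      exact ih (dL_mem_filt ha 0)
    · rw [dL_succ_mixHom]
      exact Ideal.mul_mem_left _ _ (ih (dL_mem_filt ha _))

/-- The tuple `g` agrees with `1 + t z` up to terms of length at least `2`. -/
def IsLeading (t : ℝ) (g : Fin m → ShuffleAlg ℝ m) : Prop :=
  ∀ j, g j - 1 - constS m t * zS m ∈ filt ℝ m 2

theorem IsLeading.coeff_nil {t : ℝ} {g : Fin m → ShuffleAlg ℝ m} (hg : IsLeading t g)
    (j : Fin m) : coeff [] (g j) = 1 := by
  have := hg j [] (by simp)
  simp at this
  linarith

theorem IsLeading.coeff_zero {t : ℝ} {g : Fin m → ShuffleAlg ℝ m} (hg : IsLeading t g)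
    (j : Fin m) : coeff [0] (g j) = 0 := by
  have := (mem_filt_succ.1 (dL_mem_filt (hg j) 0)).1
  simpa [dL_mul] using this

theorem IsLeading.coeff_succ {t : ℝ} {g : Fin m → ShuffleAlg ℝ m} (hg : IsLeading t g)
    (j k : Fin m) : coeff [k.succ] (g j) = t := by
  have := (mem_filt_succ.1 (dL_mem_filt (hg j) k.succ)).1
  simp [dL_mul] at this
  linarith

/-- To first order, composing with `g = 1 + t z + …` is `1 + t D`; the corrections gain two units of
length. -/
theorem mixHom_sub_mem_filt {t : ℝ} {g : Fin m → ShuffleAlg ℝ m} (hg : IsLeading t g) {n : ℕ}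
    {v : ShuffleAlg ℝ m} (hv : v ∈ filt ℝ m n) :
    mixHom g v - v - constS m t * insD v ∈ filt ℝ m (n + 2) := by
  induction n generalizing v with
  | zero =>
    refine mem_filt_succ' (by simp) (mem_filt_succ.2 ⟨?_, fun _ => mem_filt_zero _⟩)
      fun k => mem_filt_succ.2 ⟨?_, fun _ => mem_filt_zero _⟩
    · simp [dL_mul, dL_zero_insD, dL_zero_mixHom, -coeff_dL]
    · simp [dL_mul, dL_succ_insD, dL_succ_mixHom, hg.coeff_nil, -coeff_dL]
  | succ n ih =>
    refine mem_filt_succ' (by simp [hv [] (by simp)]) ?_ fun k => ?_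
    · simp only [map_sub, dL_mul, dL_zero_mixHom, dL_zero_insD, dL_constS, zero_mul, zero_add]
      exact ih (dL_mem_filt hv 0)
    · have hvk := dL_mem_filt hv k.succ
      have h1 := ih hvk
      have h2 := mixHom_mem_filt g hvk
      have h3 : mixHom g (dL k.succ v) - dL k.succ v ∈ filt ℝ m (n + 1) := by
        have := add_mem (filt_anti (Nat.le_succ _) h1)
          (Ideal.mul_mem_left _ (constS m t) (insD_mem_filt hvk))
        rwa [sub_add_cancel] at this
      have h4 := mul_mem_filt (Ideal.mul_mem_left _ (constS m t) zS_mem_filt) h3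
      have h5 := mul_mem_filt (hg k) h2
      rw [show 1 + (n + 1) = n + 2 by ring] at h4
      rw [add_comm 2 n] at h5
      have := add_mem (add_mem h1 h4) h5
      convert this using 1
      simp only [map_sub, dL_mul, dL_succ_mixHom, dL_succ_insD, dL_constS]
      ring

/-- The entries of `h` are inserted only behind a letter `x_k`, which gains one unit of length. -/
theorem mixHom_sub_mem_filt_of_tuple {n : ℕ} {h : Fin m → ShuffleAlg ℝ m}
    (hh : ∀ j, h j - 1 ∈ filt ℝ m n) (f : ShuffleAlg ℝ m) :
    mixHom h f - f ∈ filt ℝ m (n + 1) := by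
  suffices ∀ p ≤ n + 1, ∀ f : ShuffleAlg ℝ m, mixHom h f - f ∈ filt ℝ m p from
    this _ le_rfl f
  intro p
  induction p with
  | zero => exact fun _ _ => mem_filt_zero _
  | succ p ih =>
    intro hp f
    refine mem_filt_succ' (by simp) ?_ fun k => ?_
    · rw [map_sub, dL_zero_mixHom]
      exact ih (by omega) _
    · have := add_mem (Ideal.mul_mem_right (mixHom h (dL k.succ f)) _
        (filt_anti (show p ≤ n by omega) (hh k))) (ih (by omega) (dL k.succ f))
      convert this using 1
      rw [map_sub, dL_succ_mixHom]
      ring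

/-- Only the linear part `t z` of `g j` sees `h - 1` at this order: a letter `x_k` becomes `x_k (h
k)`. Longer words contribute later. -/
theorem IsLeading.mixHom_sub_mem_filt {t : ℝ} {g h : Fin m → ShuffleAlg ℝ m}
    (hg : IsLeading t g) {n : ℕ} (hh : ∀ j, h j - 1 ∈ filt ℝ m n) (j : Fin m) :
    mixHom h (g j) - g j - constS m t * letterSum (fun k => h k - 1) ∈ filt ℝ m (n + 2) := by
  refine mem_filt_succ' (by simp) ?_ fun k => ?_
  · simp only [map_sub, dL_mul, dL_zero_mixHom, dL_constS, dL_zero_letterSum, mul_zero,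
      zero_mul, add_zero, sub_zero]
    exact mixHom_sub_mem_filt_of_tuple hh _
  · have h1 : mixHom h (dL k.succ (g j)) - constS m t ∈ filt ℝ m 1 :=
      mem_filt_succ.2 ⟨by simp [hg.coeff_succ], fun _ => mem_filt_zero _⟩
    have := add_mem (mul_mem_filt (hh k) h1) (mixHom_sub_mem_filt_of_tuple hh (dL k.succ (g j)))
    convert this using 1
    simp only [map_sub, dL_mul, dL_succ_mixHom, dL_constS, dL_succ_letterSum]
    ring

/-- Expanding `g ⋆ h = h ⋆ g` with `h = 1 + v`, the terms `g j * (1 + v j)` cancel and the next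
order is `t` times the Lie bracket with `(z, …, z)`. -/
theorem letterSum_sub_insD_mem_filt {t : ℝ} (ht : t ≠ 0) {g h : Fin m → ShuffleAlg ℝ m}
    (hg : IsLeading t g) {n : ℕ} (hh : ∀ j, h j - 1 ∈ filt ℝ m (n + 1))
    (hgh : star g h = star h g) (j : Fin m) :
    letterSum (fun k => h k - 1) - insD (h j - 1) ∈ filt ℝ m (n + 3) := by
  refine mem_filt_of_constS_mul ht ?_
  set v := h j - 1 with hv
  set Z := letterSum (fun k => h k - 1) with hZ
  have h1 := hg.mixHom_sub_mem_filt hh j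
  have h2 := MultFeedback.mixHom_sub_mem_filt hg (hh j)
  have h3 : h j * mixHom h (g j) = g j * mixHom g (h j) := congrFun hgh j
  have h4 : mixHom g (h j) = 1 + mixHom g v := by rw [hv, map_sub, map_one]; ring
  rw [h4, show h j = 1 + v by rw [hv]; ring] at h3
  have hgj : g j - 1 ∈ filt ℝ m 1 :=
    mem_filt_succ.2 ⟨by simp [hg.coeff_nil], fun _ => mem_filt_zero _⟩
  have h5 : v * Z ∈ filt ℝ m (n + 3) :=
    filt_anti (by omega) (mul_mem_filt (hh j) (letterSum_mem_filt hh))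
  have h6 : (g j - 1) * insD v ∈ filt ℝ m (n + 3) :=
    filt_anti (by omega) (mul_mem_filt hgj (insD_mem_filt (hh j)))
  have := add_mem (sub_mem (Ideal.mul_mem_left _ (g j) h2) (Ideal.mul_mem_left _ (1 + v) h1))
    (Ideal.mul_mem_left _ (constS m t) (sub_mem h6 h5))
  convert this using 1
  linear_combination h3

theorem isLeading_of_commute (k₀ : Fin m) {t : ℝ} (ht : t ≠ 0) {g h : Fin m → ShuffleAlg ℝ m}
    (hg : IsLeading t g) (hh : ∀ j, coeff [] (h j) = 1) (hgh : star g h = star h g) :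
    ∃ s, IsLeading s h ∧ (s = 0 → h = 1) := by
  have hh1 : ∀ j, h j - 1 ∈ filt ℝ m 1 := fun j =>
    mem_filt_succ.2 ⟨by simp [hh], fun _ => mem_filt_zero _⟩
  obtain ⟨f, hf, -⟩ := exists_letterSum_of_commute k₀ 0 hh1
    (letterSum_sub_insD_mem_filt ht hg hh1 hgh)
  have hs : IsLeading (coeff [] f) h := by
    intro j
    have h1 : letterSum (fun _ => f) - constS m (coeff [] f) * zS m ∈ filt ℝ m 2 :=
      mem_filt_succ' (by simp) (by simp [dL_mul]) fun k =>
        mem_filt_succ.2 ⟨by simp [dL_mul, -coeff_dL], fun _ => mem_filt_zero _⟩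
    have := add_mem (hf j) h1
    rwa [sub_add_sub_cancel] at this
  refine ⟨_, hs, fun h0 => ?_⟩
  -- Once the linear part vanishes, the centralizer computation removes the leading part in each
  -- further length.
  have h2 : ∀ n j, h j - 1 ∈ filt ℝ m (n + 2) := by
    intro n
    induction n with
    | zero =>
      intro j
      have := hs j
      rwa [h0, constS_zero, zero_mul, sub_zero] at this
    | succ n ih =>
      intro j
      obtain ⟨f, hf, hf'⟩ := exists_letterSum_of_commute k₀ (n + 1) ih
        (letterSum_sub_insD_mem_filt ht hg ih hgh)
      have := add_mem (hf j) (letterSum_mem_filt fun _ => hf' (Nat.succ_ne_zero n))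
      rwa [sub_add_cancel] at this
  funext j
  exact eq_of_sub_mem_filt fun n => filt_anti (Nat.le_add_right n 2) (h2 n j)

end Leading

/-! ### The feedback groups are not powers -/

section Groups

variable {m : ℕ}

noncomputable instance : One (FeedbackGroup m) := ⟨⟨fun _ => unitSeries, fun _ => rfl⟩⟩

theorem FeedbackGroup.ext_star {c d : FeedbackGroup m} (h : c.1 = d.1) : c = d := Subtype.ext h

/-- The inverse in `M^m`. -/
noncomputable instance : Inv (FeedbackGroup m) :=
  ⟨fun c => ⟨Classical.choose (exists_star_inv (R := ℝ) c.1 c.2),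
    (Classical.choose_spec (exists_star_inv (R := ℝ) c.1 c.2)).2.2⟩⟩

noncomputable instance : Group (FeedbackGroup m) :=
  Group.ofLeftAxioms (fun a b c => FeedbackGroup.ext_star (starProd_assoc a.1 b.1 c.1))
    (fun a => FeedbackGroup.ext_star (unitSeries_starProd a.1))
    (fun a => FeedbackGroup.ext_star
      (Classical.choose_spec (exists_star_inv (R := ℝ) a.1 a.2)).1)

/-- The coefficient of `x_k` in the `j`-th component, as a homomorphism to the reals. -/
noncomputable def letterCoeff (j k : Fin m) : FeedbackGroup m →* Multiplicative ℝ :=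
  MonoidHom.mk' (fun c => Multiplicative.ofAdd (coeff [k.succ] (toSh (c.1 j)))) fun c d => by
    rw [← ofAdd_add]
    congr 1
    have hc : coeff [] (toSh (c.1 j)) = 1 := c.2 j
    have hd : ∀ j, coeff [] (toSh (d.1 j)) = 1 := d.2
    -- With all constant terms equal to `1`, the product rule makes this coefficient additive.
    change coeff [] (dL k.succ (toSh (d.1 j) * mixHom (fun i => toSh (d.1 i)) (toSh (c.1 j)))) = _
    rw [dL_mul, dL_succ_mixHom]
    simp only [coeff_add, coeff_nil_mul, coeff_nil_mixHom, hc, hd, coeff_dL]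
    ring

/-- A group with a nontrivial element such that every nontrivial element commuting with it has
abelian centralizer is abelian if it is a proper power. -/
theorem isEmpty_mulEquiv_pi {G H ι : Type*} [Group G] [MulOneClass H] [DecidableEq ι]
    [Nontrivial ι] {g : G} (hg : g ≠ 1)
    (hc : ∀ h, h ≠ 1 → Commute g h → ∀ p q, Commute h p → Commute h q → Commute p q)
    {p₀ q₀ : G} (hpq : ¬ Commute p₀ q₀) : IsEmpty (G ≃* (ι → H)) := by
  refine ⟨fun e => ?_⟩
  have e_comm : ∀ {x y : G}, e x * e y = e y * e x → Commute x y := fun h =>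
    e.injective (by rw [map_mul, map_mul, h])
  -- A power of a commutative `H` would be commutative, so `H` is not.
  obtain ⟨a, b, hab⟩ : ∃ a b : H, a * b ≠ b * a := by
    by_contra! h
    exact hpq (e_comm (funext fun i => h _ _))
  obtain ⟨i, hi⟩ : ∃ i, e g i ≠ 1 := by
    by_contra! h
    exact hg (e.injective (by rw [map_one]; exact funext h))
  obtain ⟨l, hl⟩ := exists_ne i
  -- The `i`-th coordinate of `g` placed alone commutes with the whole copy of `H` in slot `l ≠ i`.
  have key : ∀ c : H, Commute (e.symm (Pi.mulSingle i (e g i))) (e.symm (Pi.mulSingle l c)) := by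
    intro c
    refine e_comm ?_
    rw [e.apply_symm_apply, e.apply_symm_apply]
    exact Pi.mulSingle_commute hl.symm _ _
  have hcomm := hc (e.symm (Pi.mulSingle i (e g i))) ?_ ?_ _ _ (key a) (key b)
  · have := congrArg e hcomm.eq
    rw [map_mul, map_mul, e.apply_symm_apply, e.apply_symm_apply] at this
    have := congrFun this l
    simp only [Pi.mul_apply, Pi.mulSingle_eq_same] at this
    exact hab this
  · intro h
    have := congrArg e h
    rw [e.apply_symm_apply, map_one, Pi.mulSingle_eq_one_iff] at this
    exact hi this
  · refine e_comm ?_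
    rw [e.apply_symm_apply]
    funext k
    rcases eq_or_ne k i with rfl | hk
    · simp
    · simp [Pi.mulSingle_eq_of_ne hk]

theorem FeedbackGroup.isLeading_of_commute (k₀ : Fin m) {t : ℝ} (ht : t ≠ 0)
    {g h : FeedbackGroup m} (hg : IsLeading t fun j => toSh (g.1 j)) (hgh : Commute g h) :
    ∃ s, (IsLeading s fun j => toSh (h.1 j)) ∧ (s = 0 → h = 1) := by
  obtain ⟨s, hs, hs'⟩ := MultFeedback.isLeading_of_commute k₀ ht hg (h := fun j => toSh (h.1 j))
    h.2 (congrArg Subtype.val hgh.eq)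
  exact ⟨s, hs, fun h0 => FeedbackGroup.ext_star (hs' h0)⟩

/-- The element of `M^m` all of whose components are `1 + x_1 + … + x_m`. -/
noncomputable def letterElt (m : ℕ) : FeedbackGroup m :=
  ⟨fun _ => (1 + zS m : ShuffleAlg ℝ m), fun _ => by
    change coeff [] (1 + zS m) = 1
    simp⟩

/-- The element of `M^m` all of whose components are `1 + x_0`. -/
noncomputable def driftElt (m : ℕ) : FeedbackGroup m :=
  ⟨fun _ w => if w = [] ∨ w = [0] then 1 else 0, fun _ => by simp⟩

theorem isLeading_letterElt : IsLeading 1 fun j => toSh ((letterElt m).1 j) := by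
  intro j
  change 1 + zS m - 1 - constS m 1 * zS m ∈ _
  rw [constS_one, one_mul, add_sub_cancel_left, sub_self]
  exact zero_mem _

/-- The factor `H` is arbitrary, so all the comparisons in the theorem are covered at once. -/
theorem feedbackGroup_not_power (hm : 1 < m) (H : Type*) [MulOneClass H] :
    IsEmpty (FeedbackGroup m ≃* (Fin m → H)) := by
  have k₀ : Fin m := ⟨0, by omega⟩
  have : Nontrivial (Fin m) := Fin.nontrivial_iff_two_le.2 hm
  refine isEmpty_mulEquiv_pi (g := letterElt m) (p₀ := letterElt m) (q₀ := driftElt m) ?_ ?_ ?_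
  · intro h
    have h1 := isLeading_letterElt.coeff_succ k₀ k₀
    rw [h] at h1
    change coeff [k₀.succ] (1 : ShuffleAlg ℝ m) = 1 at h1
    simp at h1
  · intro h hh hgh p q hp hq
    obtain ⟨t, ht, ht'⟩ := FeedbackGroup.isLeading_of_commute k₀ one_ne_zero
      isLeading_letterElt hgh
    have ht0 : t ≠ 0 := fun h0 => hh (ht' h0)
    -- The commutator of `p` and `q` also centralizes `h`, but `letterCoeff` has abelian target and
    -- so kills it; its leading coefficient `s` is `0` and it is trivial.
    have hcomm : Commute h (p * q * p⁻¹ * q⁻¹) :=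
      ((hp.mul_right hq).mul_right hp.inv_right).mul_right hq.inv_right
    obtain ⟨s, hs, hs'⟩ := FeedbackGroup.isLeading_of_commute k₀ ht0 ht hcomm
    have h1 : letterCoeff k₀ k₀ (p * q * p⁻¹ * q⁻¹) = 1 := by
      simp only [map_mul, map_inv]
      rw [mul_right_comm _ _ (_)⁻¹, mul_inv_cancel_right, mul_inv_cancel]
    exact mul_inv_eq_iff_eq_mul.1 (mul_inv_eq_one.1 (hs' ((hs.coeff_succ k₀ k₀).symm.trans h1)))
  -- If `1 + x_0` commuted with `1 + z`, its leading term would be a multiple of `z`, which has no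
  -- `x_0`.
  · intro h
    obtain ⟨s, hs, -⟩ := FeedbackGroup.isLeading_of_commute k₀ one_ne_zero isLeading_letterElt h
    have h1 := hs.coeff_zero k₀
    simp [driftElt] at h1

/-- Only a unit is needed for `feedbackGroup_not_power`, so associativity and inverses play no role
here. -/
noncomputable instance (S : Finset (Fin m)) : MulOneClass (SingleFeedbackGroup m S) where
  one := ⟨unitSeries, rfl⟩
  one_mul d := Subtype.ext <| by
    change toSh d.1 * mixHom (fun i => if i ∈ S then d.1 else unitSeries) 1 = d.1
    rw [map_one, mul_one]
    rfl
  mul_one c := Subtype.ext <| by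
    change (1 : ShuffleAlg ℝ m) * mixHom (fun i => if i ∈ S then 1 else 1) (toSh c.1) = c.1
    simp only [ite_self]
    rw [one_mul]
    exact mixHom_one_tuple (toSh c.1)

end Groups

end MultFeedback

theorem mainTheorem7 (m : ℕ) :
    -- the coproduct of `𝓑` is dual to `⋆`
    (∀ (c d : Fin m → Series ℝ m) (j : Fin m) (w : Word m),
      evalAt₂ c d (comulB m (coord j w)) = starProd c d j w) ∧
    -- the induced maps make `𝓗` a Hopf algebra
    (∃ (hcoassoc : (Algebra.TensorProduct.assoc ℝ ℝ ℝ (FeedbackHopf m) (FeedbackHopf m)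
            (FeedbackHopf m)).toAlgHom.comp
            ((Algebra.TensorProduct.map (comulH m) (.id ℝ (FeedbackHopf m))).comp (comulH m)) =
          (Algebra.TensorProduct.map (.id ℝ (FeedbackHopf m)) (comulH m)).comp (comulH m))
        (hleft : (Algebra.TensorProduct.map (counitH m) (.id ℝ (FeedbackHopf m))).comp
            (comulH m) = (Algebra.TensorProduct.lid ℝ (FeedbackHopf m)).symm)
        (hright : (Algebra.TensorProduct.map (.id ℝ (FeedbackHopf m)) (counitH m)).comp
            (comulH m) = (Algebra.TensorProduct.rid ℝ ℝ (FeedbackHopf m)).symm),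
      letI : Bialgebra ℝ (FeedbackHopf m) :=
        Bialgebra.ofAlgHom (comulH m) (counitH m) hcoassoc hleft hright
      ∃ (S : FeedbackHopf m →ₗ[ℝ] FeedbackHopf m)
        (hS₁ : LinearMap.mul' ℝ (FeedbackHopf m) ∘ₗ S.rTensor (FeedbackHopf m) ∘ₗ
          Coalgebra.comul = Algebra.linearMap ℝ (FeedbackHopf m) ∘ₗ Coalgebra.counit)
        (hS₂ : LinearMap.mul' ℝ (FeedbackHopf m) ∘ₗ S.lTensor (FeedbackHopf m) ∘ₗ
          Coalgebra.comul = Algebra.linearMap ℝ (FeedbackHopf m) ∘ₗ Coalgebra.counit),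
      letI : HopfAlgebra ℝ (FeedbackHopf m) :=
        { antipode := S
          mul_antipode_rTensor_comul := hS₁
          mul_antipode_lTensor_comul := hS₂ }
      -- it is graded, connected and right-handed
      IsGradedConnected (hopfGrade m) ∧
      IsRightHanded (coordSpan m) (hopfGrade m) ∧
      -- its character group (with the convolution product) is `(M^m, ⋆)`
      ∃ Φ : WithConv (FeedbackHopf m →ₐ[ℝ] ℝ) ≃* FeedbackGroup m,
        ∀ (χ : WithConv (FeedbackHopf m →ₐ[ℝ] ℝ)) (j : Fin m) (w : Word m),
          (Φ χ).1 j w = χ.ofConv (proj m (coord j w))) ∧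
    -- `(M^m, ⋆)` is not an `m`-fold power of `(M, ⋆)`
    (1 < m →
      IsEmpty (FeedbackGroup m ≃* (Fin m → FeedbackGroup 1)) ∧
      ∀ S : Finset (Fin m), IsEmpty (FeedbackGroup m ≃* (Fin m → SingleFeedbackGroup m S))) := by
  refine ⟨evalAt₂_comulB_coord, ⟨comulH_coassoc m, counitH_comulH_left m, counitH_comulH_right m,
    ?_⟩, fun hm => ⟨feedbackGroup_not_power hm _, fun S => feedbackGroup_not_power hm _⟩⟩
  obtain ⟨S, hS₁, hS₂⟩ := exists_antipode m
  refine ⟨S.toLinearMap, ?_, ?_, isGradedConnected_hopfGrade m, isRightHanded_coordSpan m,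
    ⟨WithConv.equiv _ |>.trans (charEquiv m), fun χ ψ => ?_⟩, fun χ j w => rfl⟩
  · refine LinearMap.ext fun a => ?_
    exact (mul'_rTensor S _).trans (DFunLike.congr_fun hS₁ a)
  · refine LinearMap.ext fun a => ?_
    exact (mul'_lTensor S _).trans (DFunLike.congr_fun hS₂ a)
  · refine Eq.trans ?_ (charEquiv_mul χ.ofConv ψ.ofConv)
    refine congrArg (charEquiv m) (AlgHom.ext fun a => ?_)
    exact AlgHom.convMul_apply χ ψ a
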